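/- Let $d\ge 2$, $p,q\in(1,\infty)$, $r\in[p,\infty)$, $\beta\in\mathbb R$. For $\rho>0$, $(t,x)\in\mathbb R\times\mathbb R^d$ let $B_\rho(x)=\{y\in\mathbb R^d:|y-x|<\rho\}$ and $C_\rho(t,x)=[t,t+\rho^2)\times B_\rho(x)$. For measurable $g$ on $\mathbb R^{d+1}$ (scalar or vector valued) and measurable $\Gamma\subset\mathbb R^{d+1}$ put $$\|g\|_{L_{p,q}(\Gamma)}^q=\int_{\mathbb R}\Big(\int_{\mathbb R^d}|g I_\Gamma|^p\,dx\Big)^{q/p}dt,\qquad \|g\|_{\dot E_{p,q,\beta}}=\sup_{\rho>0}\ \rho^\beta\sup_{(t,x)}\ \frac{\|g\|_{L_{p,q}(C_\rho(t,x))}}{\|1\|_{L_{p,q}(C_\rho(t,x))}},$$ and for measurable $g$ on $\mathbb R^d$ and $s\in\mathbb R$ put $$\|g\|_{\dot E_{r,s}}=\sup_{\rho>0}\ \rho^{s}\sup_{x\in\mathbb R^d}|B_\rho(x)|^{-1/r}\|g\|_{L_r(B_\rho(x))}.$$ Let $\dot E_{p,q,\beta}$ be the set of measurable $g$ with $\|g\|_{\dot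 E_{p,q,\beta}}<\infty$, and $\dot E^{1,2}_{p,q,\beta}=\{u: u,Du,D^2u,\partial_tu\in\dot E_{p,q,\beta}\}$, where $D$ is the gradient in $x$ and all derivatives are Sobolev derivatives on $\mathbb R^{d+1}$; $\|\partial_tu,D^2u\|_{\dot E_{p,q,\beta}}$ denotes $\|\partial_tu\|_{\dot E_{p,q,\beta}}+\|D^2u\|_{\dot E_{p,q,\beta}}$. For a nonnegative $\zeta\in C_0^\infty(\mathbb R^{d+1})$ with unit integral and $\varepsilon>0$ let $\zeta_\varepsilon(t,x)=\varepsilon^{-d-2}\zeta(t/\varepsilon^2,x/\varepsilon)$ and $u^{(\varepsilon)}=u*\zeta_\varepsilon$. For $\gamma\in\{0,1\}$ let $D^\gamma=1$ if $\gamma=0$ and $D^\gamma=D$ if $\gamma=1$. The trace $D^\gamma u(0,\cdot)$ is the limit of $D^\gamma u^{(\varepsilon)}(0,\cdot)$ in $L_r(B)$, for every ball $B\subset\mathbb R^d$, as $\varepsilon\downarrow0$; it is called uniquely defined if this limit exists for every such $\zeta$ and, up to equality almost everywhere, is the same for all of them. **Lemma 3.7.** There is a constant $N<\infty$ depending only on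 $d,p,q,r,\beta$ such that, whenever $\gamma\in\{0,1\}$ and $$2-\gamma<\beta\le\frac dp+\frac2q<2-\gamma+\frac dr,$$ for every $u\in\dot E^{1,2}_{p,q,\beta}$ the traces $u(0,\cdot)$ and $D^\gamma u(0,\cdot)$ are uniquely defined and $$\|D^\gamma u(0,\cdot)\|_{\dot E_{r,\beta+\gamma-2}}\le N\,\|\partial_tu,D^2u\|_{\dot E_{p,q,\beta}}.$$ -/

import Mathlib

open MeasureTheory Filter Topology
open scoped ENNReal NNReal ContDiff

noncomputable section

/-- The space `ℝ^d` with its Euclidean norm. -/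
abbrev Space (d : ℕ) : Type := EuclideanSpace ℝ (Fin d)

/-- Space-time `ℝ × ℝ^d`, with points `(t, x)` and Lebesgue measure. -/
abbrev SpaceTime (d : ℕ) : Type := ℝ × Space d

/-- The parabolic cylinder `C_ρ(t, x) = [t, t + ρ²) × B_ρ(x)`. -/
def parCyl {d : ℕ} (ρ : ℝ) (z : SpaceTime d) : Set (SpaceTime d) :=
  Set.Ico z.1 (z.1 + ρ ^ 2) ×ˢ Metric.ball z.2 ρ

/-- The mixed norm `‖g‖_{L_{p,q}(Γ)} = (∫ (∫ |g I_Γ|^p dx)^{q/p} dt)^{1/q}`. -/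
def mixedNorm {d : ℕ} {F : Type*} [NormedAddCommGroup F] (p q : ℝ)
    (Γ : Set (SpaceTime d)) (g : SpaceTime d → F) : ℝ≥0∞ :=
  (∫⁻ t : ℝ, (∫⁻ x : Space d, ‖Γ.indicator g (t, x)‖ₑ ^ p) ^ (q / p)) ^ (1 / q)

/-- The normalized mixed norm `‖I_Γ‖_{L_{p,q}}⁻¹ ‖g‖_{L_{p,q}(Γ)}`. -/
def avgMixedNorm {d : ℕ} {F : Type*} [NormedAddCommGroup F] (p q : ℝ)
    (Γ : Set (SpaceTime d)) (g : SpaceTime d → F) : ℝ≥0∞ :=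
  (mixedNorm p q Γ (fun _ => (1 : ℝ)))⁻¹ * mixedNorm p q Γ g

/-- The norm of the homogeneous parabolic Morrey space `Ė_{p,q,β}`. -/
def parMorreyNorm {d : ℕ} {F : Type*} [NormedAddCommGroup F] (p q β : ℝ)
    (g : SpaceTime d → F) : ℝ≥0∞ :=
  ⨆ (ρ : ℝ) (_ : 0 < ρ) (z : SpaceTime d),
    ENNReal.ofReal ρ ^ β * avgMixedNorm p q (parCyl ρ z) g

/-- Membership in the homogeneous parabolic Morrey space `Ė_{p,q,β}`. -/
def MemParMorrey {d : ℕ} {F : Type*} [NormedAddCommGroup F] (p q β : ℝ)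
    (g : SpaceTime d → F) : Prop :=
  AEStronglyMeasurable g volume ∧ parMorreyNorm p q β g < ⊤

/-- The norm of the homogeneous Morrey space `Ė_{r,s}(ℝ^d)`:
`sup_{ρ > 0} ρ^s sup_{B ∈ 𝔹_ρ} |B|^{-1/r} ‖g‖_{L_r(B)}`. -/
def morreyNorm {d : ℕ} {F : Type*} [NormedAddCommGroup F] (r s : ℝ)
    (g : Space d → F) : ℝ≥0∞ :=
  ⨆ (ρ : ℝ) (_ : 0 < ρ) (x : Space d),
    ENNReal.ofReal ρ ^ s *
      ((volume (Metric.ball x ρ) ^ (1 / r))⁻¹ *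
        eLpNorm g (ENNReal.ofReal r) (volume.restrict (Metric.ball x ρ)))

/-- `w` is the Sobolev (weak) derivative of `u` on space-time in the direction `v`. -/
def HasWeakDeriv {d : ℕ} (v : SpaceTime d) (u w : SpaceTime d → ℝ) : Prop :=
  LocallyIntegrable u volume ∧ LocallyIntegrable w volume ∧
    ∀ φ : SpaceTime d → ℝ, ContDiff ℝ ∞ φ → HasCompactSupport φ →
      ∫ z, u z * fderiv ℝ φ z v = - ∫ z, w z * φ z

/-- The unit vector of `ℝ × ℝ^d` in the time direction. -/
def timeDir (d : ℕ) : SpaceTime d := (1, 0)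

/-- The unit vector of `ℝ × ℝ^d` in the `i`-th space direction. -/
def spaceDir {d : ℕ} (i : Fin d) : SpaceTime d := (0, EuclideanSpace.single i 1)

/-- `u` belongs to `Ė^{1,2}_{p,q,β}`, and its Sobolev derivatives `∂_t u`, `Du = (D_i u)`,
`D²u = (D_i D_j u)` are `ut`, `Du`, `D2u`. -/
structure MemParMorreySobolev {d : ℕ} (p q β : ℝ) (u ut : SpaceTime d → ℝ)
    (Du : SpaceTime d → EuclideanSpace ℝ (Fin d))
    (D2u : SpaceTime d → EuclideanSpace ℝ (Fin d × Fin d)) : Prop where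
  weak_time : HasWeakDeriv (timeDir d) u ut
  weak_space : ∀ i, HasWeakDeriv (spaceDir i) u (fun z => Du z i)
  weak_space_space : ∀ i j,
    HasWeakDeriv (spaceDir j) (fun z => Du z i) (fun z => D2u z (i, j))
  mem : MemParMorrey p q β u
  mem_time : MemParMorrey p q β ut
  mem_space : MemParMorrey p q β Du
  mem_space_space : MemParMorrey p q β D2u

/-- A nonnegative function in `C_0^∞(ℝ^{d+1})` with unit integral. -/
structure IsMollifier {d : ℕ} (ζ : SpaceTime d → ℝ) : Prop where
  smooth : ContDiff ℝ ∞ ζ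
  compact : HasCompactSupport ζ
  nonneg : ∀ z, 0 ≤ ζ z
  integral_eq_one : ∫ z, ζ z = 1

/-- The parabolic rescaling `ζ_ε(t, x) = ε^{-d-2} ζ(t/ε², x/ε)`. -/
def parRescale {d : ℕ} (ζ : SpaceTime d → ℝ) (ε : ℝ) : SpaceTime d → ℝ :=
  fun z => (ε ^ (d + 2))⁻¹ * ζ (z.1 / ε ^ 2, ε⁻¹ • z.2)

/-- The mollification `u^{(ε)} = u * ζ_ε`. -/
def mollify {d : ℕ} (ζ : SpaceTime d → ℝ) (ε : ℝ) (u : SpaceTime d → ℝ) : SpaceTime d → ℝ :=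
  convolution u (parRescale ζ ε) (ContinuousLinearMap.mul ℝ ℝ) volume

/-- `g` is the limit in `L_r(B)`, for every ball `B`, of `D^γ u^{(ε)}(0, ·)` as `ε ↓ 0`, where the
mollifications are taken with the kernel `ζ`. Here `D^γ` is the `γ`-th Fréchet derivative in `x`;
its norm is `|u|` for `γ = 0` and the Euclidean norm `|Du|` of the gradient for `γ = 1`. -/
def IsTraceAlong {d : ℕ} (ζ : SpaceTime d → ℝ) (γ : ℕ) (r : ℝ) (u : SpaceTime d → ℝ)
    (g : Space d → (Space d [×γ]→L[ℝ] ℝ)) : Prop :=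
  ∀ (x₀ : Space d) (ρ : ℝ), 0 < ρ →
    MemLp g (ENNReal.ofReal r) (volume.restrict (Metric.ball x₀ ρ)) ∧
    Tendsto
      (fun ε : ℝ => eLpNorm
        (fun x => iteratedFDeriv ℝ γ (fun y : Space d => mollify ζ ε u (0, y)) x - g x)
        (ENNReal.ofReal r) (volume.restrict (Metric.ball x₀ ρ)))
      (𝓝[>] 0) (𝓝 0)

/-- The trace `D^γ u(0, ·)` is uniquely defined and equal to `g`: for every mollification kernel the
limit defining the trace exists and is `g`, up to equality almost everywhere. -/
def IsUniqueTrace {d : ℕ} (γ : ℕ) (r : ℝ) (u : SpaceTime d → ℝ)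
    (g : Space d → (Space d [×γ]→L[ℝ] ℝ)) : Prop :=
  (∀ ζ : SpaceTime d → ℝ, IsMollifier ζ → IsTraceAlong ζ γ r u g) ∧
    ∀ ζ : SpaceTime d → ℝ, IsMollifier ζ →
      ∀ g' : Space d → (Space d [×γ]→L[ℝ] ℝ), IsTraceAlong ζ γ r u g' → g' =ᵐ[volume] g

end

/-! Put `a = 2 - γ` and let `E s` be the mollification `u * η_s`, or one of its first spatial
derivatives when `γ = 1`, for one special mollifier `η`. It is built so that its derivative in the
scale has the form `∂_t θ + Δψ` with smooth kernels `θ`, `ψ` of compact support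
(`exists_isHeatKernel`). Moving these derivatives onto `u` leaves only `∂_t u` and `D²u`, and `|E s
- E (s/2)|` is at most `C s^a` times the mean of `|∂_t u| + |D²u|` over a cylinder of radius `s`
lying in the past (`exists_mollify_sub_le`, `exists_dirDeriv_mollify_sub_le`).

Such means obey two bounds. Pointwise they are at most a constant times `s^(-β)` times the Morrey
norm (`cylMean_le`). On a time slice their `L_r` norm over a ball of radius `R ≥ s` is at most a
constant times `s^(-(d/p+2/q-d/r)) R^(d/p+2/q-β)` times the Morrey norm (`lintegral_cylMean_le`).
Telescope over dyadic scales: below `R` the second bound sums because `d/p + 2/q < a + d/r`; above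
`R` the first one sums because `a < β`. As `E s → 0` for `s → ∞`, the two sums control the limit of
`E s (0, ·)` as `s ↓ 0`, and the powers of `R` combine into the Morrey bound.

For any other mollifier `ζ`, convolution with `ζ_ε` commutes with convolution with `η_s`, and
averaging preserves the small-scale bound uniformly in `ε`. At a fixed scale `s`, `ζ_ε * E s → E s`
locally uniformly. Hence `D^γ u^(ε)(0, ·)` has the same limit for every `ζ`
(`IsScaleFamily.tendsto_eLpNorm_sub`). -/

/-! ### Minkowski and Hölder inequalities for extended nonnegative functions. -/

/-- The Minkowski integral inequality. -/
theorem lintegral_lintegral_rpow_le {α β : Type*} [MeasurableSpace α] [MeasurableSpace β]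
    {μ : Measure α} {ν : Measure β} [SFinite μ] [SFinite ν] {p : ℝ} (hp : 1 < p)
    {F : α → β → ℝ≥0∞} (hF : Measurable (Function.uncurry F)) :
    (∫⁻ x, (∫⁻ y, F x y ∂ν) ^ p ∂μ) ^ (1 / p) ≤
      ∫⁻ y, (∫⁻ x, F x y ^ p ∂μ) ^ (1 / p) ∂ν := by
  have hp0 : 0 < p := by linarith
  have hFp : Measurable (Function.uncurry fun x y => F x y ^ p) := hF.pow_const p
  have hFy : ∀ y, Measurable fun x => F x y ^ p := fun y =>
    hFp.comp (measurable_id.prodMk measurable_const)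
  set w : β → ℝ≥0∞ := fun y => (∫⁻ x, F x y ^ p ∂μ) ^ (1 / p) with hw
  have hwm : Measurable w := by
    have : Measurable fun y => ∫⁻ x, F x y ^ p ∂μ := hFp.lintegral_prod_left
    exact this.pow_const _
  have hwp : ∀ y, ∫⁻ x, F x y ^ p ∂μ = w y ^ p := fun y => by
    rw [hw, ← ENNReal.rpow_mul, one_div, inv_mul_cancel₀ hp0.ne', ENNReal.rpow_one]
  by_cases htop : ∫⁻ y, w y ∂ν = ⊤
  · rw [htop]; exact le_top
  have hwtop : ∀ᵐ y ∂ν, w y < ⊤ := ae_lt_top hwm htop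
  -- The Hölder step divides by powers of `w`; where `w` vanishes, `F` vanishes almost everywhere,
  -- so nothing is lost there.
  have hzero : ∀ᵐ x ∂μ, ∀ᵐ y ∂ν, w y = 0 → F x y = 0 := by
    have hms : MeasurableSet {z : α × β | w z.2 = 0 → F z.1 z.2 = 0} := by
      have h1 : MeasurableSet {z : α × β | w z.2 = 0} :=
        (hwm.comp measurable_snd) (measurableSet_singleton 0)
      have h2 : MeasurableSet {z : α × β | F z.1 z.2 = 0} := hF (measurableSet_singleton 0)
      have : {z : α × β | w z.2 = 0 → F z.1 z.2 = 0}
          = {z : α × β | w z.2 = 0}ᶜ ∪ {z : α × β | F z.1 z.2 = 0} := by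
        ext z; simp [imp_iff_not_or]
      rw [this]; exact h1.compl.union h2
    rw [Measure.ae_ae_comm hms]
    refine Eventually.of_forall fun y => ?_
    by_cases hy : w y = 0
    · have : ∫⁻ x, F x y ^ p ∂μ = 0 := by rw [hwp, hy, ENNReal.zero_rpow_of_pos hp0]
      rw [lintegral_eq_zero_iff (hFy y)] at this
      filter_upwards [this] with x hx _
      simpa [hp0, hp0.not_gt] using hx
    · exact Eventually.of_forall fun x h => absurd h hy
  -- Hölder for the splitting `F = (F w^(-1/p')) · w^(1/p')`. The weight is chosen so that
  -- integrating `F^p w^(1-p)` in `x` returns `w^p w^(1-p) = w`.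
  have key : ∀ᵐ x ∂μ, (∫⁻ y, F x y ∂ν) ^ p ≤
      (∫⁻ y, F x y ^ p * w y ^ (1 - p) ∂ν) * (∫⁻ y, w y ∂ν) ^ (p - 1) := by
    filter_upwards [hzero] with x hx
    set p' := p.conjExponent
    have hpp : p.HolderConjugate p' := Real.HolderConjugate.conjExponent hp
    have hp' : 0 < p' := hpp.symm.pos
    have hFx : Measurable (F x) := hF.comp (measurable_const.prodMk measurable_id)
    have h1 : ∫⁻ y, F x y ∂ν =
        ∫⁻ y, ((fun y => F x y * w y ^ (-(1 / p'))) * fun y => w y ^ (1 / p')) y ∂ν := by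
      refine lintegral_congr_ae ?_
      filter_upwards [hx, hwtop] with y hy hy'
      simp only [Pi.mul_apply]
      by_cases h0 : w y = 0
      · rw [hy h0]; simp
      · rw [mul_assoc, ← ENNReal.rpow_add _ _ h0 hy'.ne]; simp
    have h2 := ENNReal.lintegral_mul_le_Lp_mul_Lq ν hpp
      (f := fun y => F x y * w y ^ (-(1 / p'))) (g := fun y => w y ^ (1 / p'))
      (hFx.mul (hwm.pow_const _)).aemeasurable (hwm.pow_const _).aemeasurable
    rw [← h1] at h2
    have e1 : p / p' = p - 1 := hpp.div_conj_eq_sub_one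
    have h3 : ∀ y, (F x y * w y ^ (-(1 / p'))) ^ p = F x y ^ p * w y ^ (1 - p) := fun y => by
      rw [ENNReal.mul_rpow_of_nonneg _ _ hp0.le, ← ENNReal.rpow_mul]
      congr 2
      rw [← neg_sub p 1, ← e1]; ring
    have h4 : ∀ y, (w y ^ (1 / p')) ^ p' = w y := fun y => by
      rw [← ENNReal.rpow_mul, one_div, inv_mul_cancel₀ hp'.ne', ENNReal.rpow_one]
    simp only [h3, h4] at h2
    calc (∫⁻ y, F x y ∂ν) ^ p ≤ _ := ENNReal.rpow_le_rpow h2 hp0.le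
      _ = _ := by
        rw [ENNReal.mul_rpow_of_nonneg _ _ hp0.le, ← ENNReal.rpow_mul, ← ENNReal.rpow_mul,
          one_div, inv_mul_cancel₀ hp0.ne', ENNReal.rpow_one]
        congr 2
        rw [← e1]; ring
  have hle : ∫⁻ x, (∫⁻ y, F x y ∂ν) ^ p ∂μ ≤ (∫⁻ y, w y ∂ν) ^ p := by
    calc ∫⁻ x, (∫⁻ y, F x y ∂ν) ^ p ∂μ
        ≤ ∫⁻ x, (∫⁻ y, F x y ^ p * w y ^ (1 - p) ∂ν) * (∫⁻ y, w y ∂ν) ^ (p - 1) ∂μ :=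
          lintegral_mono_ae key
      _ = (∫⁻ x, ∫⁻ y, F x y ^ p * w y ^ (1 - p) ∂ν ∂μ) * (∫⁻ y, w y ∂ν) ^ (p - 1) := by
          refine lintegral_mul_const _ ?_
          exact (hFp.mul ((hwm.comp measurable_snd).pow_const (1 - p))).lintegral_prod_right
      _ = (∫⁻ y, ∫⁻ x, F x y ^ p * w y ^ (1 - p) ∂μ ∂ν) * (∫⁻ y, w y ∂ν) ^ (p - 1) := by
          rw [lintegral_lintegral_swap]
          exact (hFp.mul ((hwm.comp measurable_snd).pow_const (1 - p))).aemeasurable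
      _ ≤ (∫⁻ y, w y ∂ν) * (∫⁻ y, w y ∂ν) ^ (p - 1) := by
          gcongr with y
          rw [lintegral_mul_const _ (hFy y), hwp]
          rcases eq_or_ne (w y) 0 with h0 | h0
          · simp [h0, hp0]
          rcases eq_or_ne (w y) ⊤ with h1 | h1
          · simp [h1]
          rw [← ENNReal.rpow_add _ _ h0 h1]; simp
      _ = (∫⁻ y, w y ∂ν) ^ p := by
          rcases eq_or_ne (∫⁻ y, w y ∂ν) 0 with h0 | h0
          · rw [h0, zero_mul, ENNReal.zero_rpow_of_pos hp0]
          nth_rewrite 1 [← ENNReal.rpow_one (∫⁻ y, w y ∂ν)]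
          rw [← ENNReal.rpow_add _ _ h0 htop]; congr 1; ring
  calc _ ≤ ((∫⁻ y, w y ∂ν) ^ p) ^ (1 / p) := ENNReal.rpow_le_rpow hle (by positivity)
    _ = _ := by rw [← ENNReal.rpow_mul, mul_one_div_cancel hp0.ne', ENNReal.rpow_one]

theorem setLIntegral_le_rpow_mul {α : Type*} [MeasurableSpace α] {μ : Measure α} {p : ℝ}
    (hp : 1 < p) {A : Set α} {f : α → ℝ≥0∞} (hf : AEMeasurable f μ) :
    ∫⁻ x in A, f x ∂μ ≤ (∫⁻ x, f x ^ p ∂μ) ^ (1 / p) * μ A ^ (1 - 1 / p) := by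
  have hp0 : 0 < p := by linarith
  have hpp : p.HolderConjugate p.conjExponent := Real.HolderConjugate.conjExponent hp
  have h := ENNReal.lintegral_mul_le_Lp_mul_Lq (μ.restrict A) hpp (f := f) (g := fun _ => 1)
    hf.restrict aemeasurable_const
  have e : 1 / p.conjExponent = 1 - 1 / p := by
    have := hpp.inv_add_inv_eq_one
    rw [one_div, one_div]; linarith
  simp only [Pi.mul_apply, mul_one, ENNReal.one_rpow, lintegral_const, Measure.restrict_apply,
    MeasurableSet.univ, Set.univ_inter, one_mul, e] at h
  refine h.trans ?_
  gcongr
  exact Measure.restrict_le_self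

instance isAddHaarMeasure_spaceTime (d : ℕ) :
    (volume : Measure (SpaceTime d)).IsAddHaarMeasure :=
  inferInstanceAs (((volume : Measure ℝ).prod (volume : Measure (Space d))).IsAddHaarMeasure)

/-- The mixed norm of a nonnegative function on the whole space-time. -/
noncomputable def mixedLNorm {d : ℕ} (p q : ℝ) (h : SpaceTime d → ℝ≥0∞) : ℝ≥0∞ :=
  (∫⁻ t : ℝ, (∫⁻ x : Space d, h (t, x) ^ p) ^ (q / p)) ^ (1 / q)

/-! ### Mixed norms and means over parabolic cylinders. -/

section Mixed
variable {d : ℕ} {p q : ℝ}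

theorem mixedNorm_eq {F : Type*} [NormedAddCommGroup F] (Γ : Set (SpaceTime d))
    (g : SpaceTime d → F) :
    mixedNorm p q Γ g = mixedLNorm p q (Γ.indicator fun z => ‖g z‖ₑ) := by
  simp only [mixedNorm, mixedLNorm, enorm_indicator_eq_indicator_enorm]

theorem mixedLNorm_congr {h h' : SpaceTime d → ℝ≥0∞} (hh : h =ᵐ[volume] h') :
    mixedLNorm p q h = mixedLNorm p q h' := by
  unfold mixedLNorm
  congr 1
  refine lintegral_congr_ae ?_
  have := Measure.ae_ae_of_ae_prod (μ := (volume : Measure ℝ)) (ν := (volume : Measure (Space d))) hh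
  filter_upwards [this] with t ht
  congr 1
  refine lintegral_congr_ae ?_
  filter_upwards [ht] with x hx
  rw [hx]

theorem mixedLNorm_indicator_congr {h h' : SpaceTime d → ℝ≥0∞} (hh : h =ᵐ[volume] h')
    (Γ : Set (SpaceTime d)) :
    mixedLNorm p q (Γ.indicator h) = mixedLNorm p q (Γ.indicator h') := by
  refine mixedLNorm_congr ?_
  filter_upwards [hh] with z hz
  simp only [Set.indicator, hz]

theorem setLIntegral_spaceNorm_le (hq : 1 < q) {h : SpaceTime d → ℝ≥0∞}
    (hh : Measurable h) (I : Set ℝ) :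
    ∫⁻ t in I, (∫⁻ x : Space d, h (t, x) ^ p) ^ (1 / p) ≤
      mixedLNorm p q h * volume I ^ (1 - 1 / q) := by
  have hm : Measurable fun t => ∫⁻ x : Space d, h (t, x) ^ p :=
    Measurable.lintegral_prod_right' (f := fun z : SpaceTime d => h z ^ p) (hh.pow_const p)
  refine (setLIntegral_le_rpow_mul hq (hm.pow_const _).aemeasurable).trans_eq ?_
  simp only [mixedLNorm, ← ENNReal.rpow_mul]
  congr 4
  ext t
  congr 1
  ring

theorem setLIntegral_prod_le (hp : 1 < p) (hq : 1 < q) {h : SpaceTime d → ℝ≥0∞}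
    (hh : Measurable h) (I : Set ℝ) (B : Set (Space d)) :
    ∫⁻ z in I ×ˢ B, h z ≤
      mixedLNorm p q h * volume I ^ (1 - 1 / q) * volume B ^ (1 - 1 / p) := by
  rw [Measure.volume_eq_prod, ← Measure.prod_restrict, lintegral_prod _ hh.aemeasurable]
  have hm : Measurable fun t => ∫⁻ x : Space d, h (t, x) ^ p :=
    Measurable.lintegral_prod_right' (f := fun z : SpaceTime d => h z ^ p) (hh.pow_const p)
  calc ∫⁻ t in I, ∫⁻ x in B, h (t, x)
      ≤ ∫⁻ t in I, (∫⁻ x, h (t, x) ^ p) ^ (1 / p) * volume B ^ (1 - 1 / p) := by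
        gcongr with t
        exact setLIntegral_le_rpow_mul hp (hh.comp (by fun_prop)).aemeasurable
    _ ≤ _ := by
        rw [lintegral_mul_const _ (hm.pow_const _)]
        gcongr
        exact setLIntegral_spaceNorm_le hq hh I

theorem measurableSet_parCyl (ρ : ℝ) (z : SpaceTime d) : MeasurableSet (parCyl ρ z) :=
  measurableSet_Ico.prod measurableSet_ball

/-- The volume of the unit ball of `ℝ^d`. -/
noncomputable def ballVol (d : ℕ) : ℝ≥0∞ := volume (Metric.ball (0 : Space d) 1)

theorem ballVol_ne_top : ballVol d ≠ ⊤ := measure_ball_lt_top.ne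

theorem ballVol_ne_zero : ballVol d ≠ 0 := (Metric.measure_ball_pos _ _ one_pos).ne'

theorem volume_ball_eq (x : Space d) {ρ : ℝ} (hρ : 0 < ρ) :
    volume (Metric.ball x ρ) = ENNReal.ofReal ρ ^ (d : ℝ) * ballVol d := by
  rw [Measure.addHaar_ball_of_pos _ _ hρ, finrank_euclideanSpace_fin, ballVol,
    ENNReal.ofReal_pow hρ.le, ENNReal.rpow_natCast]

theorem mixedNorm_one (hp : 0 < p) (hq : 0 < q) {ρ : ℝ} (hρ : 0 < ρ) (z : SpaceTime d) :
    mixedNorm p q (parCyl ρ z) (fun _ => (1 : ℝ)) =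
      (ENNReal.ofReal ρ ^ (d : ℝ) * ballVol d) ^ (1 / p) * (ENNReal.ofReal ρ ^ (2 : ℝ)) ^ (1 / q) := by
  have h1 : ∀ t : ℝ, (∫⁻ x : Space d, ((parCyl ρ z).indicator (fun _ => ‖(1 : ℝ)‖ₑ) (t, x)) ^ p)
      ^ (q / p) = (Set.Ico z.1 (z.1 + ρ ^ 2)).indicator
        (fun _ => (ENNReal.ofReal ρ ^ (d : ℝ) * ballVol d) ^ (q / p)) t := fun t => by
    by_cases ht : t ∈ Set.Ico z.1 (z.1 + ρ ^ 2)
    · rw [Set.indicator_of_mem ht, ← volume_ball_eq z.2 hρ]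
      congr 1
      rw [← lintegral_indicator_one measurableSet_ball]
      refine lintegral_congr fun x => ?_
      by_cases hx : x ∈ Metric.ball z.2 ρ
      · rw [Set.indicator_of_mem (show (t, x) ∈ parCyl ρ z from ⟨ht, hx⟩),
          Set.indicator_of_mem hx]; simp
      · rw [Set.indicator_of_notMem (fun h : (t, x) ∈ parCyl ρ z => hx h.2),
          Set.indicator_of_notMem hx]; simp [hp]
    · rw [Set.indicator_of_notMem ht]
      have : ∀ x : Space d, ((parCyl ρ z).indicator (fun _ => ‖(1 : ℝ)‖ₑ) (t, x)) ^ p = 0 :=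
        fun x => by
          rw [Set.indicator_of_notMem (fun h : (t, x) ∈ parCyl ρ z => ht h.1)]; simp [hp]
      simp only [this, lintegral_zero]
      exact ENNReal.zero_rpow_of_pos (by positivity)
  rw [mixedNorm_eq, mixedLNorm]
  simp only [h1]
  rw [lintegral_indicator measurableSet_Ico, setLIntegral_const, Real.volume_Ico,
    ENNReal.mul_rpow_of_nonneg _ _ (by positivity), ← ENNReal.rpow_mul, add_sub_cancel_left,
    ENNReal.ofReal_pow hρ.le, ← ENNReal.rpow_natCast]
  congr 2
  field_simp

/-- The normalized integral of `h` over the cylinder of radius `s` lying below `z`. -/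
noncomputable def cylMean (s : ℝ) (h : SpaceTime d → ℝ≥0∞) (z : SpaceTime d) : ℝ≥0∞ :=
  ENNReal.ofReal s ^ (-(d + 2) : ℝ) * ∫⁻ w in parCyl s (z.1 - s ^ 2, z.2), h w

theorem cylMean_congr {s : ℝ} {h h' : SpaceTime d → ℝ≥0∞} (hh : h =ᵐ[volume] h')
    (z : SpaceTime d) : cylMean s h z = cylMean s h' z := by
  unfold cylMean
  rw [lintegral_congr_ae (ae_restrict_of_ae hh)]

theorem measurable_cylMean {h : SpaceTime d → ℝ≥0∞} (hh : AEMeasurable h volume) (s : ℝ) :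
    Measurable (cylMean s h) := by
  rw [show cylMean s h = cylMean s (hh.mk h) from
    funext fun z => cylMean_congr hh.ae_eq_mk z]
  have hm := hh.measurable_mk
  set h' := hh.mk h
  unfold cylMean
  refine Measurable.const_mul ?_ _
  have : ∀ z : SpaceTime d, ∫⁻ w in parCyl s (z.1 - s ^ 2, z.2), h' w =
      ∫⁻ w, {v : SpaceTime d × SpaceTime d |
        v.2 ∈ parCyl s (v.1.1 - s ^ 2, v.1.2)}.indicator (fun v => h' v.2) (z, w) := fun z => by
    rw [← lintegral_indicator (measurableSet_parCyl _ _)]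
    rfl
  simp only [this]
  refine Measurable.lintegral_prod_right ?_
  refine (hm.comp measurable_snd).indicator ?_
  have e : {v : SpaceTime d × SpaceTime d | v.2 ∈ parCyl s (v.1.1 - s ^ 2, v.1.2)} =
      {v | v.1.1 - s ^ 2 ≤ v.2.1} ∩ {v | v.2.1 < v.1.1 - s ^ 2 + s ^ 2} ∩
        {v | dist v.2.2 v.1.2 < s} := by
    ext v; simp [parCyl, and_assoc]
  rw [e]
  refine MeasurableSet.inter (MeasurableSet.inter ?_ ?_) ?_
  · exact measurableSet_le (by fun_prop) (by fun_prop)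
  · exact measurableSet_lt (by fun_prop) (by fun_prop)
  · exact measurableSet_lt (by fun_prop) (by fun_prop)

end Mixed

/-! ### Bounds of cylinder means by the parabolic Morrey norm. -/

section MorreyBounds
variable {d : ℕ} {p q : ℝ} {F : Type*} [NormedAddCommGroup F]

theorem avgMixedNorm_le {β ρ : ℝ} (hρ : 0 < ρ) (z : SpaceTime d) (g : SpaceTime d → F) :
    avgMixedNorm p q (parCyl ρ z) g ≤ ENNReal.ofReal ρ ^ (-β) * parMorreyNorm p q β g := by
  have h0 : ENNReal.ofReal ρ ≠ 0 := by simpa using hρ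
  have h : ENNReal.ofReal ρ ^ β * avgMixedNorm p q (parCyl ρ z) g ≤ parMorreyNorm p q β g :=
    le_iSup_of_le ρ (le_iSup_of_le hρ (le_iSup_of_le z le_rfl))
  calc avgMixedNorm p q (parCyl ρ z) g
      = ENNReal.ofReal ρ ^ (-β) * (ENNReal.ofReal ρ ^ β * avgMixedNorm p q (parCyl ρ z) g) := by
        rw [← mul_assoc, ← ENNReal.rpow_add _ _ h0 ENNReal.ofReal_ne_top]; simp
    _ ≤ _ := by gcongr

theorem mixedNorm_le {β ρ : ℝ} (hp : 0 < p) (hq : 0 < q) (hρ : 0 < ρ) (z : SpaceTime d)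
    (g : SpaceTime d → F) :
    mixedNorm p q (parCyl ρ z) g ≤
      ballVol d ^ (1 / p) * ENNReal.ofReal ρ ^ (d / p + 2 / q - β) * parMorreyNorm p q β g := by
  have h0 : ENNReal.ofReal ρ ≠ 0 := by simpa using hρ
  have ht : ENNReal.ofReal ρ ≠ ⊤ := ENNReal.ofReal_ne_top
  have e := mixedNorm_one (d := d) hp hq hρ z
  have e1 : mixedNorm p q (parCyl ρ z) (fun _ => (1 : ℝ)) =
      ballVol d ^ (1 / p) * ENNReal.ofReal ρ ^ (d / p + 2 / q) := by
    rw [e, ENNReal.mul_rpow_of_nonneg _ _ (by positivity), ← ENNReal.rpow_mul, ← ENNReal.rpow_mul,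
      ENNReal.rpow_add _ _ h0 ht, mul_one_div, mul_one_div]
    ring
  have hne : mixedNorm p q (parCyl ρ z) (fun _ => (1 : ℝ)) ≠ 0 := by
    rw [e1]
    exact mul_ne_zero (by simp [ENNReal.rpow_eq_zero_iff, ballVol_ne_zero, ballVol_ne_top])
      (by simp [ENNReal.rpow_eq_zero_iff, h0, ht])
  have hnt : mixedNorm p q (parCyl ρ z) (fun _ => (1 : ℝ)) ≠ ⊤ := by
    rw [e1]
    exact ENNReal.mul_ne_top (by simp [ENNReal.rpow_eq_top_iff, ballVol_ne_zero, ballVol_ne_top])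
      (by simp [ENNReal.rpow_eq_top_iff, h0, ht])
  calc mixedNorm p q (parCyl ρ z) g
      = mixedNorm p q (parCyl ρ z) (fun _ => (1 : ℝ)) * avgMixedNorm p q (parCyl ρ z) g := by
        rw [avgMixedNorm, ← mul_assoc, ENNReal.mul_inv_cancel hne hnt, one_mul]
    _ ≤ (ballVol d ^ (1 / p) * ENNReal.ofReal ρ ^ (d / p + 2 / q)) *
        (ENNReal.ofReal ρ ^ (-β) * parMorreyNorm p q β g) := by
        rw [e1]; gcongr; exact avgMixedNorm_le hρ z g
    _ = _ := by
        rw [sub_eq_add_neg, ENNReal.rpow_add (d / p + 2 / q) (-β) h0 ht]; ring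

theorem setLIntegral_parCyl_le (hp : 1 < p) (hq : 1 < q) {h : SpaceTime d → ℝ≥0∞}
    (hh : Measurable h) {s : ℝ} (hs : 0 < s) (z : SpaceTime d) :
    ∫⁻ w in parCyl s z, h w ≤ mixedLNorm p q h * (ENNReal.ofReal s ^ (2 : ℝ)) ^ (1 - 1 / q) *
      (ENNReal.ofReal s ^ (d : ℝ) * ballVol d) ^ (1 - 1 / p) := by
  have := setLIntegral_prod_le hp hq hh (Set.Ico z.1 (z.1 + s ^ 2)) (Metric.ball z.2 s)
  rwa [Real.volume_Ico, add_sub_cancel_left, volume_ball_eq _ hs, ENNReal.ofReal_pow hs.le,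
    ← ENNReal.rpow_natCast] at this

theorem cylMean_le_mixedNorm (hp : 1 < p) (hq : 1 < q) {g : SpaceTime d → F}
    (hg : AEStronglyMeasurable g volume) {s : ℝ} (hs : 0 < s) (z : SpaceTime d) :
    cylMean s (fun w => ‖g w‖ₑ) z ≤ ballVol d ^ (1 - 1 / p) *
      ENNReal.ofReal s ^ (-(d / p + 2 / q)) * mixedNorm p q (parCyl s (z.1 - s ^ 2, z.2)) g := by
  have h0 : ENNReal.ofReal s ≠ 0 := by simpa using hs
  have ht : ENNReal.ofReal s ≠ ⊤ := ENNReal.ofReal_ne_top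
  have hp1 : 0 ≤ 1 - 1 / p := by
    rw [sub_nonneg, div_le_one (by linarith)]; exact hp.le
  set Γ := parCyl s (z.1 - s ^ 2, z.2)
  have hge : AEMeasurable (fun w => ‖g w‖ₑ) volume := hg.enorm
  have hm := hge.measurable_mk
  rw [cylMean_congr hge.ae_eq_mk z, mixedNorm_eq, mixedLNorm_indicator_congr hge.ae_eq_mk Γ]
  set h := hge.mk _
  have hΓ : MeasurableSet Γ := measurableSet_parCyl _ _
  have := setLIntegral_parCyl_le hp hq (hm.indicator hΓ) hs (z.1 - s ^ 2, z.2)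
  rw [setLIntegral_indicator hΓ, Set.inter_self] at this
  calc cylMean s h z ≤ ENNReal.ofReal s ^ (-(d + 2) : ℝ) * _ := mul_le_mul_right this _
    _ = _ := by
      rw [ENNReal.mul_rpow_of_nonneg _ _ hp1, ← ENNReal.rpow_mul, ← ENNReal.rpow_mul]
      have : (-(d / p + 2 / q) : ℝ) = -(d + 2) + 2 * (1 - 1 / q) + d * (1 - 1 / p) := by ring
      rw [this, ENNReal.rpow_add _ _ h0 ht, ENNReal.rpow_add _ _ h0 ht]
      ring

/-- Pointwise bound of the normalized integrals by the parabolic Morrey norm. -/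
theorem cylMean_le (hp : 1 < p) (hq : 1 < q) {g : SpaceTime d → F}
    (hg : AEStronglyMeasurable g volume) (β : ℝ) {s : ℝ} (hs : 0 < s) (z : SpaceTime d) :
    cylMean s (fun w => ‖g w‖ₑ) z ≤
      ballVol d * ENNReal.ofReal s ^ (-β) * parMorreyNorm p q β g := by
  have h0 : ENNReal.ofReal s ≠ 0 := by simpa using hs
  have ht : ENNReal.ofReal s ≠ ⊤ := ENNReal.ofReal_ne_top
  refine (cylMean_le_mixedNorm hp hq hg hs z).trans ((mul_le_mul_right
    (mixedNorm_le (β := β) (by linarith) (by linarith) hs _ g) _).trans_eq ?_)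
  calc _ = (ballVol d ^ (1 - 1 / p) * ballVol d ^ (1 / p)) * (ENNReal.ofReal s ^ (-(d / p + 2 / q)) *
        ENNReal.ofReal s ^ (d / p + 2 / q - β)) * parMorreyNorm p q β g := by ring
    _ = _ := by
      rw [← ENNReal.rpow_add _ _ h0 ht, ← ENNReal.rpow_add _ _ ballVol_ne_zero ballVol_ne_top]
      congr 3
      · rw [sub_add_cancel, ENNReal.rpow_one]
      · ring

/-- On a time slice the mean is a spatial average of translates. Hölder bounds it in the supremum
norm, Minkowski bounds it in `L_p`, and interpolating between `p` and `∞` gives `L_r`. Passing from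
`L_∞` to `L_r` improves the power of `s` by `d/r`, which is the gain that makes small scales
summable. -/
theorem lintegral_cylMean_le_mixedNorm {r : ℝ} (hp : 1 < p) (hq : 1 < q) (hr : p ≤ r)
    {g : SpaceTime d → F} (hg : AEStronglyMeasurable g volume) {s R : ℝ} (hs : 0 < s)
    (hsR : s ≤ R) (t : ℝ) (x₀ : Space d) :
    (∫⁻ x in Metric.ball x₀ R, cylMean s (fun w => ‖g w‖ₑ) (t, x) ^ r) ^ (1 / r) ≤
      ballVol d ^ (1 - 1 / p + 1 / r) * ENNReal.ofReal s ^ (-(d / p + 2 / q - d / r)) *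
        mixedNorm p q (parCyl (2 * R) (t - (2 * R) ^ 2, x₀)) g := by
  have hp0 : 0 < p := by linarith
  have hr0 : 0 < r := by linarith
  have h0 : ENNReal.ofReal s ≠ 0 := by simpa using hs
  have ht : ENNReal.ofReal s ≠ ⊤ := ENNReal.ofReal_ne_top
  have hp1 : 0 ≤ 1 - 1 / p := by
    rw [sub_nonneg, div_le_one (by linarith)]; exact hp.le
  have hpr : 0 ≤ 1 - p / r := by
    rw [sub_nonneg, div_le_one hr0]; exact hr
  -- Since `s ≤ R`, this cylinder contains every cylinder of radius `s` below a point `(t, x)` with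
  -- `x` in the ball, so the function may be cut off to it.
  set W := parCyl (2 * R) (t - (2 * R) ^ 2, x₀)
  have hW : MeasurableSet W := measurableSet_parCyl _ _
  have hge : AEMeasurable (fun w => ‖g w‖ₑ) volume := hg.enorm
  have hm := hge.measurable_mk
  simp only [fun z => cylMean_congr (s := s) hge.ae_eq_mk z]
  rw [mixedNorm_eq, mixedLNorm_indicator_congr hge.ae_eq_mk W]
  set h := W.indicator (hge.mk _) with hh
  have hhm : Measurable h := hm.indicator hW
  set m := mixedLNorm p q h
  set A := ENNReal.ofReal s ^ (d : ℝ) * ballVol d with hA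
  set X := m * (ENNReal.ofReal s ^ (2 : ℝ)) ^ (1 - 1 / q) with hX
  set Q : Set (SpaceTime d) := Set.Ico (t - s ^ 2) t ×ˢ Metric.ball 0 s with hQ
  set G : Space d → ℝ≥0∞ := fun x => ∫⁻ w in parCyl s (t - s ^ 2, x), h w with hG
  have hGeq : ∀ x ∈ Metric.ball x₀ R, cylMean s (hge.mk _) (t, x) =
      ENNReal.ofReal s ^ (-(d + 2) : ℝ) * G x := fun x hx => by
    rw [cylMean, hG]
    congr 1
    refine setLIntegral_congr_fun (measurableSet_parCyl _ _) fun w hw => ?_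
    have hwW : w ∈ W := by
      obtain ⟨⟨h1, h2⟩, h3⟩ := hw
      simp only [Metric.mem_ball] at h1 h2 h3 hx
      refine ⟨⟨?_, ?_⟩, ?_⟩
      · simp only
        nlinarith
      · simp only; linarith
      · simp only [Metric.mem_ball]
        linarith [dist_triangle w.2 x x₀]
    rw [hh, Set.indicator_of_mem hwW]
  have hGtrans : ∀ x, G x = ∫⁻ w in Q, h ((0, x) + w) := fun x => by
    rw [hG]
    simp only
    rw [← lintegral_indicator (measurableSet_parCyl _ _),
      ← lintegral_indicator (measurableSet_Ico.prod measurableSet_ball),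
      ← lintegral_add_left_eq_self _ ((0, x) : SpaceTime d)]
    refine lintegral_congr fun w => ?_
    have : (0, x) + w ∈ parCyl s (t - s ^ 2, x) ↔ w ∈ Q := by
      simp [parCyl, hQ, Metric.mem_ball, dist_eq_norm]
    by_cases hw : w ∈ Q
    · rw [Set.indicator_of_mem hw, Set.indicator_of_mem (this.2 hw)]
    · rw [Set.indicator_of_notMem hw, Set.indicator_of_notMem (mt this.1 hw)]
  -- The two endpoints of the interpolation: this supremum bound, and the `L_p` bound `hLp`, which
  -- has a whole factor `A` because only Minkowski is applied in space.
  have hsup : ∀ x, G x ≤ X * A ^ (1 - 1 / p) := fun x => setLIntegral_parCyl_le hp hq hhm hs _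
  have hGm : Measurable G := by
    rw [funext hGtrans]
    exact Measurable.lintegral_prod_right (f := fun (x : Space d) (w : SpaceTime d) => h ((0, x) + w))
      (hhm.comp (by fun_prop))
  have hLp : (∫⁻ x, G x ^ p) ^ (1 / p) ≤ X * A := by
    simp only [hGtrans]
    calc _ ≤ _ := lintegral_lintegral_rpow_le (ν := volume.restrict Q) hp
          (F := fun (x : Space d) (w : SpaceTime d) => h ((0, x) + w)) (hhm.comp (by fun_prop))
      _ = ∫⁻ w in Q, (∫⁻ x : Space d, h (w.1, x) ^ p) ^ (1 / p) := by
          refine lintegral_congr fun w => ?_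
          congr 1
          rw [← lintegral_add_left_eq_self (fun x => h (w.1, x) ^ p) w.2]
          refine lintegral_congr fun x => ?_
          rw [add_comm w.2 x, show ((0, x) + w : SpaceTime d) = (w.1, x + w.2) from
            Prod.ext (zero_add _) rfl]
      _ = (∫⁻ τ in Set.Ico (t - s ^ 2) t, (∫⁻ x : Space d, h (τ, x) ^ p) ^ (1 / p)) * A := by
          have hmm : Measurable fun τ => ∫⁻ x : Space d, h (τ, x) ^ p :=
            Measurable.lintegral_prod_right' (f := fun z : SpaceTime d => h z ^ p)
              (hhm.pow_const p)
          rw [hQ, Measure.volume_eq_prod, ← Measure.prod_restrict, lintegral_prod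
            (fun w : SpaceTime d => (∫⁻ x : Space d, h (w.1, x) ^ p) ^ (1 / p))
            ((hmm.comp measurable_fst).pow_const _).aemeasurable]
          simp only [lintegral_const, Measure.restrict_apply MeasurableSet.univ, Set.univ_inter]
          rw [volume_ball_eq _ hs, lintegral_mul_const _ (hmm.pow_const _)]
      _ ≤ _ := by
          gcongr
          refine (setLIntegral_spaceNorm_le hq hhm _).trans_eq ?_
          rw [Real.volume_Ico, sub_sub_cancel, ENNReal.ofReal_pow hs.le, ← ENNReal.rpow_natCast]
          rfl
  have hGr : (∫⁻ x, G x ^ r) ^ (1 / r) ≤ X * A ^ (1 - 1 / p + 1 / r) := by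
    have hLp' : ∫⁻ x, G x ^ p ≤ (X * A) ^ p := by
      calc ∫⁻ x, G x ^ p = ((∫⁻ x, G x ^ p) ^ (1 / p)) ^ p := by
            rw [← ENNReal.rpow_mul, one_div_mul_cancel hp0.ne', ENNReal.rpow_one]
        _ ≤ _ := ENNReal.rpow_le_rpow hLp hp0.le
    have h1 : ∫⁻ x, G x ^ r ≤ (X * A ^ (1 - 1 / p)) ^ (r - p) * (X * A) ^ p := by
      calc ∫⁻ x, G x ^ r = ∫⁻ x, G x ^ (r - p) * G x ^ p := by
            refine lintegral_congr fun x => ?_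
            rw [← ENNReal.rpow_add_of_nonneg _ _ (by linarith) hp0.le, sub_add_cancel]
        _ ≤ ∫⁻ x, (X * A ^ (1 - 1 / p)) ^ (r - p) * G x ^ p := by
            gcongr with x
            exact hsup x
        _ = (X * A ^ (1 - 1 / p)) ^ (r - p) * ∫⁻ x, G x ^ p :=
            lintegral_const_mul _ (hGm.pow_const _)
        _ ≤ _ := by gcongr
    calc _ ≤ ((X * A ^ (1 - 1 / p)) ^ (r - p) * (X * A) ^ p) ^ (1 / r) :=
          ENNReal.rpow_le_rpow h1 (by positivity)
      _ = X ^ (1 - p / r) * X ^ (p / r) * (A ^ ((1 - 1 / p) * (1 - p / r)) * A ^ (p / r)) := by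
          rw [ENNReal.mul_rpow_of_nonneg _ _ (by positivity : 0 ≤ 1 / r), ← ENNReal.rpow_mul,
            ← ENNReal.rpow_mul, show (r - p) * (1 / r) = 1 - p / r by field_simp,
            ENNReal.mul_rpow_of_nonneg _ _ hpr, mul_one_div,
            ENNReal.mul_rpow_of_nonneg _ _ (by positivity : 0 ≤ p / r), ← ENNReal.rpow_mul]
          ring
      _ = _ := by
          rw [← ENNReal.rpow_add_of_nonneg _ _ hpr (by positivity),
            ← ENNReal.rpow_add_of_nonneg _ _ (by positivity) (by positivity), sub_add_cancel,
            ENNReal.rpow_one]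
          congr 2
          field_simp
          ring
  have hfin : ∫⁻ x in Metric.ball x₀ R, cylMean s (hge.mk _) (t, x) ^ r ≤
      (ENNReal.ofReal s ^ (-(d + 2) : ℝ)) ^ r * ∫⁻ x, G x ^ r := by
    rw [← lintegral_const_mul _ (hGm.pow_const _)]
    calc _ = ∫⁻ x in Metric.ball x₀ R, (ENNReal.ofReal s ^ (-(d + 2) : ℝ)) ^ r * G x ^ r := by
          refine setLIntegral_congr_fun measurableSet_ball fun x hx => ?_
          rw [hGeq x hx, ENNReal.mul_rpow_of_nonneg _ _ hr0.le]
      _ ≤ _ := setLIntegral_le_lintegral _ _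
  calc _ ≤ ((ENNReal.ofReal s ^ (-(d + 2) : ℝ)) ^ r * ∫⁻ x, G x ^ r) ^ (1 / r) :=
        ENNReal.rpow_le_rpow hfin (by positivity)
    _ = ENNReal.ofReal s ^ (-(d + 2) : ℝ) * (∫⁻ x, G x ^ r) ^ (1 / r) := by
        rw [ENNReal.mul_rpow_of_nonneg _ _ (by positivity : 0 ≤ 1 / r), ← ENNReal.rpow_mul,
          mul_one_div_cancel hr0.ne', ENNReal.rpow_one]
    _ ≤ ENNReal.ofReal s ^ (-(d + 2) : ℝ) * (X * A ^ (1 - 1 / p + 1 / r)) := by gcongr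
    _ = _ := by
        rw [hX, hA, ENNReal.mul_rpow_of_nonneg _ _ (by positivity), ← ENNReal.rpow_mul,
          ← ENNReal.rpow_mul]
        have : (-(d / p + 2 / q - d / r) : ℝ) =
          -(d + 2) + 2 * (1 - 1 / q) + d * (1 - 1 / p + 1 / r) := by ring
        rw [this, ENNReal.rpow_add _ _ h0 ht, ENNReal.rpow_add _ _ h0 ht]
        ring

/-- The `L_r` bound of the normalized integrals on balls by the parabolic Morrey norm. -/
theorem lintegral_cylMean_le {r : ℝ} (hp : 1 < p) (hq : 1 < q) (hr : p ≤ r) (β : ℝ)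
    {g : SpaceTime d → F} (hg : AEStronglyMeasurable g volume) {s R : ℝ} (hs : 0 < s)
    (hsR : s ≤ R) (t : ℝ) (x₀ : Space d) :
    (∫⁻ x in Metric.ball x₀ R, cylMean s (fun w => ‖g w‖ₑ) (t, x) ^ r) ^ (1 / r) ≤
      (ballVol d ^ (1 + 1 / r) * 2 ^ (d / p + 2 / q - β)) *
        ENNReal.ofReal s ^ (-(d / p + 2 / q - d / r)) *
        ENNReal.ofReal R ^ (d / p + 2 / q - β) * parMorreyNorm p q β g := by
  have hR : 0 < R := by linarith
  have h2 : ENNReal.ofReal (2 * R) ^ (d / p + 2 / q - β) =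
      2 ^ (d / p + 2 / q - β) * ENNReal.ofReal R ^ (d / p + 2 / q - β) := by
    rw [ENNReal.ofReal_mul (by norm_num), ENNReal.mul_rpow_of_ne_top (by simp) (by simp)]
    simp
  refine (lintegral_cylMean_le_mixedNorm hp hq hr hg hs hsR t x₀).trans ((mul_le_mul_right
    (mixedNorm_le (β := β) (by linarith) (by linarith) (by linarith : 0 < 2 * R) _ g) _).trans_eq ?_)
  rw [h2, show (1 + 1 / r : ℝ) = (1 - 1 / p + 1 / r) + 1 / p by ring,
    ENNReal.rpow_add (1 - 1 / p + 1 / r) (1 / p) ballVol_ne_zero ballVol_ne_top]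
  ring

end MorreyBounds

/-! ### Smooth kernels, their parabolic rescalings and convolutions. -/

section Kernels
variable {d : ℕ}

/-- The directional derivative of a function on space-time. -/
noncomputable def dirDeriv (v : SpaceTime d) (f : SpaceTime d → ℝ) : SpaceTime d → ℝ :=
  fun z => fderiv ℝ f z v

/-- The convolution of two real functions on space-time. -/
noncomputable def conv (u κ : SpaceTime d → ℝ) : SpaceTime d → ℝ :=
  convolution u κ (ContinuousLinearMap.mul ℝ ℝ) volume

/-- A smooth kernel supported in the unit cylinder. -/
structure IsUnitKernel (κ : SpaceTime d → ℝ) : Prop where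
  smooth : ContDiff ℝ ∞ κ
  tsupport_subset : tsupport κ ⊆ Set.Ioo 0 1 ×ˢ Metric.ball 0 1

/-- The generator `(τ, y) ↦ (2τ, y)` of the parabolic dilations. -/
noncomputable def dilGen (d : ℕ) : SpaceTime d →L[ℝ] SpaceTime d :=
  ((2 : ℝ) • ContinuousLinearMap.fst ℝ ℝ (Space d)).prod (ContinuousLinearMap.snd ℝ ℝ (Space d))

/-- The derivative of the parabolic rescalings of `κ` at unit scale. -/
noncomputable def eulerOp (κ : SpaceTime d → ℝ) : SpaceTime d → ℝ :=
  fun z => -(d + 2 : ℝ) * κ z - fderiv ℝ κ z (dilGen d z)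

theorem contDiff_dirDeriv {κ : SpaceTime d → ℝ} (hκ : ContDiff ℝ ∞ κ) (v : SpaceTime d) :
    ContDiff ℝ ∞ (dirDeriv v κ) :=
  (hκ.fderiv_right (m := ∞) le_rfl).clm_apply contDiff_const

theorem HasCompactSupport.dirDeriv {κ : SpaceTime d → ℝ} (hκ : HasCompactSupport κ)
    (v : SpaceTime d) : HasCompactSupport (dirDeriv v κ) :=
  hκ.fderiv_apply ℝ v

namespace IsUnitKernel
variable {κ : SpaceTime d → ℝ}

theorem hasCompactSupport (hκ : IsUnitKernel κ) : HasCompactSupport κ := by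
  refine HasCompactSupport.of_support_subset_isCompact
    ((isCompact_Icc (a := (0 : ℝ)) (b := 1)).prod (isCompact_closedBall (0 : Space d) 1))
    ((subset_tsupport κ).trans (hκ.tsupport_subset.trans ?_))
  exact Set.prod_mono Set.Ioo_subset_Icc_self Metric.ball_subset_closedBall

theorem mem_of_ne_zero (hκ : IsUnitKernel κ) {z : SpaceTime d} (hz : κ z ≠ 0) :
    (0 < z.1 ∧ z.1 < 1) ∧ ‖z.2‖ < 1 := by
  have := hκ.tsupport_subset (subset_tsupport κ hz)
  simpa using! this

theorem exists_bound (hκ : IsUnitKernel κ) : ∃ C : ℝ≥0, ∀ z, ‖κ z‖ₑ ≤ C := by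
  obtain ⟨C, hC⟩ := hκ.hasCompactSupport.exists_bound_of_continuous hκ.smooth.continuous
  refine ⟨C.toNNReal, fun z => ?_⟩
  rw [← ofReal_norm]
  exact ENNReal.ofReal_le_ofReal (hC z)

theorem dirDeriv (hκ : IsUnitKernel κ) (v : SpaceTime d) : IsUnitKernel (dirDeriv v κ) where
  smooth := contDiff_dirDeriv hκ.smooth v
  tsupport_subset := (tsupport_fderiv_apply_subset ℝ v).trans hκ.tsupport_subset

theorem eulerOp (hκ : IsUnitKernel κ) : IsUnitKernel (eulerOp κ) where
  smooth := (contDiff_const.mul hκ.smooth).sub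
    ((hκ.smooth.fderiv_right (m := ∞) le_rfl).clm_apply (dilGen d).contDiff)
  tsupport_subset := by
    refine Set.Subset.trans (closure_minimal (fun z hz => ?_) (isClosed_tsupport κ))
      hκ.tsupport_subset
    by_contra h
    refine hz ?_
    have h1 : κ z = 0 := image_eq_zero_of_notMem_tsupport h
    have h2 : fderiv ℝ κ z = 0 := by
      by_contra h3
      exact h (support_fderiv_subset ℝ h3)
    simp [_root_.eulerOp, h1, h2]

end IsUnitKernel

theorem contDiff_parRescale {κ : SpaceTime d → ℝ} (hκ : ContDiff ℝ ∞ κ) (s : ℝ) :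
    ContDiff ℝ ∞ (parRescale κ s) := by
  unfold parRescale
  refine contDiff_const.mul (hκ.comp ?_)
  simp only [div_eq_mul_inv]
  fun_prop

theorem hasCompactSupport_parRescale {κ : SpaceTime d → ℝ} (hκ : HasCompactSupport κ) {s : ℝ}
    (hs : 0 < s) : HasCompactSupport (parRescale κ s) := by
  have hc : Continuous fun z : SpaceTime d => ((s ^ 2 * z.1, s • z.2) : SpaceTime d) := by fun_prop
  refine HasCompactSupport.intro (hκ.isCompact.image hc) fun z hz => ?_
  unfold parRescale
  rw [image_eq_zero_of_notMem_tsupport (f := κ), mul_zero]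
  refine fun h => hz ⟨_, h, ?_⟩
  ext
  · simp only; field_simp
  · simp [smul_smul, hs.ne']

theorem IsUnitKernel.mem_of_parRescale_ne_zero {κ : SpaceTime d → ℝ} (hκ : IsUnitKernel κ) {s : ℝ}
    (hs : 0 < s) {z : SpaceTime d} (hz : parRescale κ s z ≠ 0) :
    (0 < z.1 ∧ z.1 < s ^ 2) ∧ ‖z.2‖ < s := by
  obtain ⟨⟨h1, h2⟩, h3⟩ := hκ.mem_of_ne_zero (right_ne_zero_of_mul hz)
  simp only [norm_smul, norm_inv, Real.norm_eq_abs, abs_of_pos hs] at h1 h2 h3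
  have hs2 : 0 < s ^ 2 := by positivity
  refine ⟨⟨?_, ?_⟩, ?_⟩
  · exact (div_pos_iff_of_pos_right hs2).1 h1
  · exact (div_lt_one hs2).1 h2
  · rwa [inv_mul_lt_iff₀ hs, mul_one] at h3

theorem dirDeriv_parRescale {κ : SpaceTime d → ℝ} (hκ : ContDiff ℝ ∞ κ) (v : SpaceTime d)
    (s : ℝ) (z : SpaceTime d) :
    dirDeriv v (parRescale κ s) z =
      (s ^ (d + 2))⁻¹ * fderiv ℝ κ (z.1 / s ^ 2, s⁻¹ • z.2) (v.1 / s ^ 2, s⁻¹ • v.2) := by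
  set δ : SpaceTime d →L[ℝ] SpaceTime d :=
    ((s ^ 2)⁻¹ • ContinuousLinearMap.fst ℝ ℝ (Space d)).prod
      (s⁻¹ • ContinuousLinearMap.snd ℝ ℝ (Space d)) with hδ
  have hδ' : ∀ w : SpaceTime d, δ w = (w.1 / s ^ 2, s⁻¹ • w.2) := fun w => by
    simp [hδ, div_eq_inv_mul]
  have : parRescale κ s = fun w => (s ^ (d + 2))⁻¹ * κ (δ w) := by
    funext w; rw [hδ', parRescale]
  rw [dirDeriv, this]
  have h := ((hκ.differentiable (by simp) (δ z)).hasFDerivAt.comp z δ.hasFDerivAt).const_mul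
    ((s ^ (d + 2))⁻¹)
  have h' := h.fderiv
  simp only [Function.comp_def] at h'
  rw [h', ← hδ', ← hδ']
  rfl

theorem dirDeriv_timeDir_parRescale {κ : SpaceTime d → ℝ} (hκ : ContDiff ℝ ∞ κ) {s : ℝ}
    (hs : 0 < s) :
    parRescale (dirDeriv (timeDir d) κ) s = fun z => s ^ 2 * dirDeriv (timeDir d) (parRescale κ s) z := by
  funext z
  rw [dirDeriv_parRescale hκ]
  have : (((timeDir d).1 / s ^ 2, s⁻¹ • (timeDir d).2) : SpaceTime d) = (s ^ 2)⁻¹ • timeDir d := by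
    simp [timeDir]
  rw [this, map_smul, parRescale, dirDeriv, smul_eq_mul]
  field_simp

theorem dirDeriv_space_parRescale {κ : SpaceTime d → ℝ} (hκ : ContDiff ℝ ∞ κ) {s : ℝ}
    (hs : 0 < s) (i : Fin d) :
    parRescale (dirDeriv (spaceDir i) κ) s =
      fun z => s * dirDeriv (spaceDir i) (parRescale κ s) z := by
  funext z
  rw [dirDeriv_parRescale hκ]
  have : (((spaceDir i).1 / s ^ 2, s⁻¹ • (spaceDir i).2) : SpaceTime d) = s⁻¹ • spaceDir i := by
    simp [spaceDir]
  rw [this, map_smul, parRescale, dirDeriv, smul_eq_mul]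
  field_simp

/-- The kernel lives at times in `(0, 1)`, so the convolution at `z` only sees times before that of
`z`; a single cylinder below `z` covers its support, and the normalization `s^(-d-2)` of the
rescaling is that of the mean. -/
theorem enorm_conv_parRescale_le {κ : SpaceTime d → ℝ} (hκ : IsUnitKernel κ) {C : ℝ≥0}
    (hC : ∀ z, ‖κ z‖ₑ ≤ C) {s : ℝ} (hs : 0 < s) (f : SpaceTime d → ℝ) (z : SpaceTime d) :
    ‖conv f (parRescale κ s) z‖ₑ ≤ C * cylMean s (fun w => ‖f w‖ₑ) z := by
  have hs0 : ENNReal.ofReal s ≠ 0 := by simpa using hs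
  have hc : ‖(s ^ (d + 2))⁻¹‖ₑ = ENNReal.ofReal s ^ (-(d + 2) : ℝ) := by
    rw [Real.enorm_of_nonneg (by positivity), ENNReal.ofReal_inv_of_pos (by positivity),
      ENNReal.ofReal_pow hs.le, ENNReal.rpow_neg]
    norm_cast
  unfold conv cylMean
  rw [convolution_def]
  calc ‖∫ w, ContinuousLinearMap.mul ℝ ℝ (f w) (parRescale κ s (z - w))‖ₑ
      ≤ ∫⁻ w, ‖ContinuousLinearMap.mul ℝ ℝ (f w) (parRescale κ s (z - w))‖ₑ :=
        enorm_integral_le_lintegral_enorm _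
    _ ≤ ∫⁻ w, (C * ENNReal.ofReal s ^ (-(d + 2) : ℝ)) *
          (parCyl s (z.1 - s ^ 2, z.2)).indicator (fun w => ‖f w‖ₑ) w := by
        refine lintegral_mono fun w => ?_
        by_cases hw : parRescale κ s (z - w) = 0
        · simp [hw]
        · have hmem : w ∈ parCyl s (z.1 - s ^ 2, z.2) := by
            obtain ⟨⟨h1, h2⟩, h3⟩ := hκ.mem_of_parRescale_ne_zero hs hw
            simp only [Prod.fst_sub, Prod.snd_sub] at h1 h2 h3
            refine ⟨⟨?_, ?_⟩, ?_⟩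
            · simp only; linarith
            · simp only; linarith
            · rwa [Metric.mem_ball, dist_eq_norm, norm_sub_rev]
          rw [Set.indicator_of_mem hmem, ContinuousLinearMap.mul_apply', enorm_mul, parRescale,
            enorm_mul, hc]
          calc _ ≤ ‖f w‖ₑ * (ENNReal.ofReal s ^ (-(d + 2) : ℝ) * C) := by gcongr; exact hC _
            _ = _ := by ring
    _ = _ := by
        rw [lintegral_const_mul' _ _ (ENNReal.mul_ne_top ENNReal.coe_ne_top
          (ENNReal.rpow_ne_top_of_ne_zero hs0 ENNReal.ofReal_ne_top)),
          lintegral_indicator (measurableSet_parCyl _ _), mul_assoc]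

theorem cylMean_mono {s : ℝ} {h h' : SpaceTime d → ℝ≥0∞} (hh : ∀ z, h z ≤ h' z)
    (z : SpaceTime d) : cylMean s h z ≤ cylMean s h' z := by
  unfold cylMean
  gcongr with w
  exact hh w

/-- Lets one mean at scale `s` dominate all scales in a dyadic interval: the smaller cylinder is
contained in the larger one, and the normalizations differ by at most `2^(d+2)`. -/
theorem cylMean_le_two_pow {s σ : ℝ} (hσ : 0 < σ) (h1 : s / 2 ≤ σ) (h2 : σ ≤ s)
    (h : SpaceTime d → ℝ≥0∞) (z : SpaceTime d) :
    cylMean σ h z ≤ 2 ^ (d + 2) * cylMean s h z := by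
  have hs : 0 < s := by linarith
  unfold cylMean
  have hsub : parCyl σ (z.1 - σ ^ 2, z.2) ⊆ parCyl s (z.1 - s ^ 2, z.2) := by
    refine Set.prod_mono ?_ (Metric.ball_subset_ball h2)
    simp only [sub_add_cancel]
    refine Set.Ico_subset_Ico_left ?_
    nlinarith
  have hc : ENNReal.ofReal σ ^ (-(d + 2) : ℝ) ≤
      2 ^ (d + 2) * ENNReal.ofReal s ^ (-(d + 2) : ℝ) := by
    rw [ENNReal.ofReal_rpow_of_pos hσ, ENNReal.ofReal_rpow_of_pos hs,
      show (2 : ℝ≥0∞) = ENNReal.ofReal 2 by simp, ← ENNReal.ofReal_pow (by norm_num),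
      ← ENNReal.ofReal_mul (by positivity)]
    refine ENNReal.ofReal_le_ofReal ?_
    rw [Real.rpow_neg hσ.le, Real.rpow_neg hs.le]
    have e : ∀ x : ℝ, x ^ (d + 2 : ℝ) = x ^ (d + 2) := fun x => by norm_cast
    rw [e, e, ← div_eq_mul_inv, le_div_iff₀ (by positivity), inv_mul_le_iff₀ (by positivity),
      ← mul_pow]
    exact pow_le_pow_left₀ hs.le (by linarith) _
  calc _ ≤ (2 ^ (d + 2) * ENNReal.ofReal s ^ (-(d + 2) : ℝ)) *
        ∫⁻ w in parCyl s (z.1 - s ^ 2, z.2), h w := by gcongr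
    _ = _ := by ring

/-- The weak derivative is tested against `y ↦ κ (z - y)`; the sign from the reflection cancels the
one from integration by parts. -/
theorem conv_dirDeriv {v : SpaceTime d} {u w : SpaceTime d → ℝ} (huw : HasWeakDeriv v u w)
    {κ : SpaceTime d → ℝ} (hκ : ContDiff ℝ ∞ κ) (hc : HasCompactSupport κ) :
    conv u (dirDeriv v κ) = conv w κ := by
  funext z
  unfold conv
  simp only [convolution_def, ContinuousLinearMap.mul_apply']
  have hφc : HasCompactSupport fun y => κ (z - y) :=
    hc.comp_homeomorph (Homeomorph.subLeft z)
  have h := huw.2.2 (fun y => κ (z - y)) (hκ.comp (contDiff_const.sub contDiff_id)) hφc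
  have h1 : ∀ y, fderiv ℝ (fun y => κ (z - y)) y v = - dirDeriv v κ (z - y) := fun y => by
    have := (hκ.differentiable (by simp) (z - y)).hasFDerivAt.comp y
      ((hasFDerivAt_id y).const_sub z)
    have h' := this.fderiv
    simp only [Function.comp_def] at h'
    rw [h']
    simp [dirDeriv]
  simp only [h1, mul_neg, integral_neg, neg_inj] at h
  exact h

theorem dirDeriv_conv {u κ : SpaceTime d → ℝ} (hu : LocallyIntegrable u volume)
    (hκ : ContDiff ℝ ∞ κ) (hc : HasCompactSupport κ) (v : SpaceTime d) :
    dirDeriv v (conv u κ) = conv u (dirDeriv v κ) := by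
  funext z
  have hκ1 : ContDiff ℝ 1 κ := hκ.of_le (by exact_mod_cast le_top)
  have h := hc.hasFDerivAt_convolution_right (ContinuousLinearMap.mul ℝ ℝ) hu hκ1 z
  unfold dirDeriv conv
  rw [h.fderiv, convolution_precompR_apply _ hu (hc.fderiv ℝ) (hκ1.continuous_fderiv one_ne_zero)]

theorem continuous_conv {u κ : SpaceTime d → ℝ} (hu : LocallyIntegrable u volume)
    (hκ : Continuous κ) (hc : HasCompactSupport κ) : Continuous (conv u κ) :=
  hc.continuous_convolution_right _ hu hκ

theorem conv_const_mul (u κ : SpaceTime d → ℝ) (c : ℝ) (z : SpaceTime d) :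
    conv u (fun w => c * κ w) z = c * conv u κ z := by
  simp only [conv, convolution_def, ContinuousLinearMap.mul_apply']
  rw [← integral_const_mul]
  congr 1; ext w; ring

theorem conv_add {u κ κ' : SpaceTime d → ℝ} (hu : LocallyIntegrable u volume)
    (hκ : Continuous κ) (hc : HasCompactSupport κ) (hκ' : Continuous κ')
    (hc' : HasCompactSupport κ') : conv u (fun w => κ w + κ' w) = fun z => conv u κ z + conv u κ' z :=
  funext fun _ => ConvolutionExistsAt.distrib_add (hc.convolutionExists_right _ hu hκ _)
    (hc'.convolutionExists_right _ hu hκ' _)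

/-- By the chain rule `s ∂_s` acts on the rescaled kernels as a fixed operator at unit scale:
`-(d+2)` comes from the amplitude, the generator of dilations from the argument. -/
theorem hasDerivAt_parRescale {κ : SpaceTime d → ℝ} (hκ : ContDiff ℝ ∞ κ) {s : ℝ} (hs : 0 < s)
    (w : SpaceTime d) :
    HasDerivAt (fun σ => parRescale κ σ w) (s⁻¹ * parRescale (eulerOp κ) s w) s := by
  have h1 : HasDerivAt (fun σ : ℝ => ((w.1 / σ ^ 2, σ⁻¹ • w.2) : SpaceTime d))
      (-s⁻¹ • dilGen d (w.1 / s ^ 2, s⁻¹ • w.2)) s := by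
    have ha : HasDerivAt (fun σ : ℝ => w.1 / σ ^ 2) (-s⁻¹ * (2 * (w.1 / s ^ 2))) s := by
      have := (hasDerivAt_const s w.1).div (hasDerivAt_pow 2 s) (by positivity)
      convert! this using 1
      field_simp
      simp
      ring
    have hb : HasDerivAt (fun σ : ℝ => σ⁻¹ • w.2) (-s⁻¹ • s⁻¹ • w.2) s := by
      have := (hasDerivAt_inv hs.ne').smul_const w.2
      convert! this using 1
      rw [smul_smul]; congr 1; field_simp
    convert! ha.prodMk hb using 1
  have h2 := (hκ.differentiable (by simp) (w.1 / s ^ 2, s⁻¹ • w.2)).hasFDerivAt.comp_hasDerivAt s h1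
  have h3 : HasDerivAt (fun σ : ℝ => (σ ^ (d + 2))⁻¹) (-s⁻¹ * (d + 2) * (s ^ (d + 2))⁻¹) s := by
    have := (hasDerivAt_pow (d + 2) s).inv (by positivity)
    convert! this using 1
    push_cast
    have : s ^ (d + 2) ≠ 0 := by positivity
    field_simp
    ring
  have h4 := h3.mul h2
  unfold parRescale
  convert! h4 using 1
  simp only [eulerOp, map_smul, smul_eq_mul, Function.comp_def]
  ring

theorem hasDerivAt_conv_parRescale {u κ : SpaceTime d → ℝ} (hu : LocallyIntegrable u volume)
    (hκ : IsUnitKernel κ) {s : ℝ} (hs : 0 < s) (z : SpaceTime d) :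
    HasDerivAt (fun σ => conv u (parRescale κ σ) z) (s⁻¹ * conv u (parRescale (eulerOp κ) s) z) s := by
  obtain ⟨C, hC⟩ := hκ.eulerOp.exists_bound
  -- For all `σ < 2s` the translated kernels vanish off this one compact set, and `σ > s/2` bounds
  -- their amplitudes; this gives the integrable majorant.
  set K : Set (SpaceTime d) :=
    (fun w => z - w) ⁻¹' (Set.Icc 0 ((2 * s) ^ 2) ×ˢ Metric.closedBall 0 (2 * s)) with hK
  have hKc : IsCompact K := (Homeomorph.subLeft z).isCompact_preimage.2
    (isCompact_Icc.prod (isCompact_closedBall _ _))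
  rw [← conv_const_mul]
  unfold conv
  simp only [convolution_def, ContinuousLinearMap.mul_apply']
  have hpos : ∀ σ ∈ Metric.ball s (s / 2), s / 2 < σ ∧ σ < 2 * s := fun σ hσ => by
    rw [Metric.mem_ball, Real.dist_eq, abs_lt] at hσ
    constructor <;> linarith
  refine (hasDerivAt_integral_of_dominated_loc_of_deriv_le (s := Metric.ball s (s / 2))
    (F' := fun σ w => u w * (σ⁻¹ * parRescale (eulerOp κ) σ (z - w)))
    (bound := K.indicator fun w => ‖u w‖ * ((s / 2)⁻¹ * (((s / 2) ^ (d + 2))⁻¹ * C)))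
    (Metric.ball_mem_nhds s (by positivity)) ?_ ?_ ?_ ?_ ?_ ?_).2
  · refine Eventually.of_forall fun σ => ?_
    exact hu.aestronglyMeasurable.mul
      ((contDiff_parRescale hκ.smooth σ).continuous.comp (by fun_prop)).aestronglyMeasurable
  · exact (hasCompactSupport_parRescale hκ.hasCompactSupport hs).convolutionExists_right
      (ContinuousLinearMap.mul ℝ ℝ) hu (contDiff_parRescale hκ.smooth s).continuous z
  · exact hu.aestronglyMeasurable.mul (Continuous.aestronglyMeasurable (continuous_const.mul
      ((contDiff_parRescale hκ.eulerOp.smooth s).continuous.comp (by fun_prop))))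
  · refine Eventually.of_forall fun w σ hσ => ?_
    obtain ⟨h1, h2⟩ := hpos σ hσ
    have hσ0 : 0 < σ := by linarith
    by_cases hw : parRescale (eulerOp κ) σ (z - w) = 0
    · rw [hw, mul_zero, mul_zero, norm_zero]
      exact Set.indicator_nonneg (fun _ _ => by positivity) _
    · obtain ⟨⟨h3, h4⟩, h5⟩ := hκ.eulerOp.mem_of_parRescale_ne_zero hσ0 hw
      have hwK : w ∈ K := by
        refine ⟨⟨h3.le, h4.le.trans ?_⟩, ?_⟩
        · exact pow_le_pow_left₀ hσ0.le h2.le 2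
        · rw [Metric.mem_closedBall, dist_zero_right]; linarith
      rw [Set.indicator_of_mem hwK, norm_mul, norm_mul, parRescale, norm_mul, norm_inv, norm_inv,
        norm_pow, Real.norm_of_nonneg hσ0.le]
      have hC' : ∀ y, ‖eulerOp κ y‖ ≤ C := fun y => by
        have := hC y
        rwa [enorm_le_coe] at this
      gcongr
      exact hC' _
  · rw [integrable_indicator_iff hKc.measurableSet]
    exact (hu.integrableOn_isCompact hKc).norm.mul_const _
  · refine Eventually.of_forall fun w σ hσ => ?_
    exact (hasDerivAt_parRescale hκ.smooth (by linarith [(hpos σ hσ).1]) (z - w)).const_mul _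

end Kernels

/-! ### Construction of the special mollifier. -/

section KernelIdentity
variable {d : ℕ}

theorem sum_spaceDir (z : SpaceTime d) :
    z = z.1 • timeDir d + ∑ i, z.2 i • spaceDir i := by
  ext i
  · simp [timeDir, spaceDir, Prod.fst_sum]
  · simp [timeDir, spaceDir, Prod.snd_sum, Pi.single_apply]

theorem dilGen_spaceDir (j : Fin d) : dilGen d (spaceDir j) = spaceDir j := by
  simp [dilGen, spaceDir]

/-- The commutator of a spatial derivative with the dilation generator is that same derivative,
spatial directions having weight one; symmetry of the second derivative handles the rest. -/
theorem dirDeriv_eulerOp {κ : SpaceTime d → ℝ} (hκ : ContDiff ℝ ∞ κ) (j : Fin d)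
    (z : SpaceTime d) :
    dirDeriv (spaceDir j) (eulerOp κ) z =
      eulerOp (dirDeriv (spaceDir j) κ) z - dirDeriv (spaceDir j) κ z := by
  have hf : ContDiff ℝ ∞ (fderiv ℝ κ) := hκ.fderiv_right (m := ∞) le_rfl
  have hf1 := (hf.differentiable (by simp) z).hasFDerivAt
  have hκ1 := (hκ.differentiable (by simp) z).hasFDerivAt
  have h1 := (hκ1.const_mul (-(d + 2 : ℝ))).sub (hf1.clm_apply (dilGen d).hasFDerivAt)
  have h2 := hf1.clm_apply (hasFDerivAt_const (spaceDir j) z)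
  have hsymm : IsSymmSndFDerivAt ℝ κ z :=
    (hκ.of_le (m := 2) (WithTop.coe_le_coe.2 le_top)).contDiffAt.isSymmSndFDerivAt (by simp)
  have e1 : dirDeriv (spaceDir j) (eulerOp κ) z = _ := congrArg (· (spaceDir j)) h1.fderiv
  have e2 : fderiv ℝ (dirDeriv (spaceDir j) κ) z = _ := h2.fderiv
  rw [e1, eulerOp, e2]
  simp [dirDeriv, dilGen_spaceDir, hsymm.eq (spaceDir j) (dilGen d z)]
  ring

/-- A mollifier whose derivative with respect to the scale is the sum of a time derivative and a
spatial Laplacian of kernels. -/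
structure IsHeatKernel (η θ ψ : SpaceTime d → ℝ) : Prop where
  mollifier : IsMollifier η
  kernel : IsUnitKernel η
  kernel_time : IsUnitKernel θ
  kernel_space : IsUnitKernel ψ
  euler_eq : eulerOp η = fun z =>
    dirDeriv (timeDir d) θ z + ∑ i, dirDeriv (spaceDir i) (dirDeriv (spaceDir i) ψ) z

/-- The Euler operator is a divergence: `-(d+2)η - 2τ ∂_τ η - y·Dη = ∂_τ(-2τη) + div(-yη)`. If the
field `-yη` is the gradient of `ψ`, the last term is `Δψ`, which provides the second space
derivative. -/
theorem eulerOp_eq_of_gradient {η ψ : SpaceTime d → ℝ} (hη : ContDiff ℝ ∞ η)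
    (hψ : ∀ i z, dirDeriv (spaceDir i) ψ z = -(z.2 i * η z)) (z : SpaceTime d) :
    eulerOp η z = dirDeriv (timeDir d) (fun z => -2 * z.1 * η z) z +
      ∑ i, dirDeriv (spaceDir i) (dirDeriv (spaceDir i) ψ) z := by
  have hη1 := (hη.differentiable (by simp) z).hasFDerivAt
  have h1 : dirDeriv (timeDir d) (fun z => -2 * z.1 * η z) z =
      -2 * η z - 2 * z.1 * fderiv ℝ η z (timeDir d) := by
    have := (((hasFDerivAt_fst (𝕜 := ℝ) (p := z)).const_mul (-2)).mul hη1).fderiv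
    rw [dirDeriv]
    refine (congrArg (· (timeDir d)) this).trans ?_
    simp [timeDir]
    ring
  have h2 : ∀ i, dirDeriv (spaceDir i) (dirDeriv (spaceDir i) ψ) z =
      -η z - z.2 i * fderiv ℝ η z (spaceDir i) := fun i => by
    have hp : HasFDerivAt (fun z : SpaceTime d => z.2 i)
        ((EuclideanSpace.proj (𝕜 := ℝ) i).comp (ContinuousLinearMap.snd ℝ ℝ (Space d))) z :=
      ((EuclideanSpace.proj (𝕜 := ℝ) i).comp
        (ContinuousLinearMap.snd ℝ ℝ (Space d))).hasFDerivAt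
    have := (hp.mul hη1).neg.fderiv
    rw [funext (hψ i), dirDeriv]
    refine (congrArg (· (spaceDir i)) this).trans ?_
    simp [spaceDir]
    ring
  have h3 : fderiv ℝ η z (dilGen d z) = 2 * z.1 * fderiv ℝ η z (timeDir d) +
      ∑ i, z.2 i * fderiv ℝ η z (spaceDir i) := by
    rw [sum_spaceDir (dilGen d z)]
    simp [dilGen]
  rw [h1, Finset.sum_congr rfl fun i _ => h2 i, eulerOp, h3]
  simp
  ring

/-- Take `ψ = a(τ) B(|y|²)` with `B` decreasing. Its spatial gradient is `2 a B'(|y|²) y`, hence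
equals `-yη` for `η = -2 a B'(|y|²) ≥ 0`. It remains to divide by the integral of `η`. -/
theorem exists_isHeatKernel (hd : 0 < d) : ∃ η θ ψ : SpaceTime d → ℝ, IsHeatKernel η θ ψ := by
  -- The bump is supported in `[1/4, 3/4]`, and `B` vanishes from `1/2` on, so both kernels stay
  -- well inside the unit cylinder.
  let a : ContDiffBump (1 / 2 : ℝ) := ⟨1 / 8, 1 / 4, by norm_num, by norm_num⟩
  let B : ℝ → ℝ := fun v => Real.smoothTransition (1 - 2 * v)
  have hB : ContDiff ℝ ∞ B :=
    Real.smoothTransition.contDiff.comp (contDiff_const.sub (contDiff_const.mul contDiff_id))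
  have hBanti : Antitone B := fun v w hvw => Real.smoothTransition.monotone (by linarith)
  have hBzero : ∀ v, 1 / 2 ≤ v → B v = 0 := fun v hv =>
    Real.smoothTransition.zero_of_nonpos (by linarith)
  have hB0 : B 0 = 1 := Real.smoothTransition.one_of_one_le (by norm_num)
  have hB' : ContDiff ℝ ∞ (deriv B) := (contDiff_infty_iff_deriv.1 hB).2
  have hB'zero : ∀ v, 1 / 2 < v → deriv B v = 0 := fun v hv => by
    have : B =ᶠ[𝓝 v] fun _ => 0 := by
      filter_upwards [lt_mem_nhds hv] with w hw using hBzero w hw.le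
    rw [this.deriv_eq, deriv_const]
  have hnsq : ContDiff ℝ ∞ fun z : SpaceTime d => ‖z.2‖ ^ 2 := contDiff_snd.norm_sq ℝ
  have hsupp : ∀ f : ℝ → ℝ, (∀ v, 1 / 2 < v → f v = 0) →
      tsupport (fun z : SpaceTime d => a z.1 * f (‖z.2‖ ^ 2)) ⊆
        Set.Ioo 0 1 ×ˢ Metric.ball 0 1 := fun f hf => by
    have hcl : IsClosed (Metric.closedBall (1 / 2 : ℝ) (1 / 4) ×ˢ
        {y : Space d | ‖y‖ ^ 2 ≤ 1 / 2}) :=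
      Metric.isClosed_closedBall.prod (isClosed_le (by fun_prop) continuous_const)
    have hin : Function.support (fun z : SpaceTime d => a z.1 * f (‖z.2‖ ^ 2)) ⊆
        Metric.closedBall (1 / 2 : ℝ) (1 / 4) ×ˢ {y : Space d | ‖y‖ ^ 2 ≤ 1 / 2} := by
      refine fun z hz => ⟨?_, ?_⟩
      · exact a.tsupport_eq ▸ subset_tsupport a (left_ne_zero_of_mul hz)
      · by_contra h
        exact right_ne_zero_of_mul hz (hf _ (not_le.1 h))
    refine (closure_minimal hin hcl).trans (Set.prod_mono ?_ ?_)
    · intro t ht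
      rw [Metric.mem_closedBall, Real.dist_eq, abs_le] at ht
      constructor <;> linarith
    · intro y hy
      rw [mem_ball_zero_iff]
      rw [Set.mem_ofPred_eq] at hy
      nlinarith [norm_nonneg y]
  have hac : ContDiff ℝ ∞ fun z : SpaceTime d => a z.1 := a.contDiff.comp contDiff_fst
  let η₀ : SpaceTime d → ℝ := fun z => a z.1 * (-2 * deriv B (‖z.2‖ ^ 2))
  let ψ₀ : SpaceTime d → ℝ := fun z => a z.1 * B (‖z.2‖ ^ 2)
  have hη₀ : IsUnitKernel η₀ :=
    ⟨hac.mul (contDiff_const.mul (hB'.comp hnsq)),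
      hsupp (fun v => -2 * deriv B v) fun v hv => by rw [hB'zero v hv, mul_zero]⟩
  have hψ₀ : IsUnitKernel ψ₀ := ⟨hac.mul (hB.comp hnsq), hsupp B fun v hv => hBzero v hv.le⟩
  have hη₀nn : ∀ z, 0 ≤ η₀ z := fun z =>
    mul_nonneg a.nonneg (by nlinarith [hBanti.deriv_nonpos (x := ‖z.2‖ ^ 2)])
  have hgrad : ∀ i z, dirDeriv (spaceDir i) ψ₀ z = -(z.2 i * η₀ z) := fun i z => by
    have h1 : HasFDerivAt (fun z : SpaceTime d => a z.1) _ z :=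
      (a.contDiff.differentiable (n := ∞) (by simp) z.1).hasFDerivAt.comp z hasFDerivAt_fst
    have h2 : HasFDerivAt (fun z : SpaceTime d => ‖z.2‖ ^ 2) _ z :=
      (hasFDerivAt_snd (𝕜 := ℝ) (p := z)).norm_sq
    have h3 := ((hB.differentiable (by simp) (‖z.2‖ ^ 2)).hasDerivAt.comp_hasFDerivAt z h2)
    refine (congrArg (· (spaceDir i)) (h1.mul h3).fderiv).trans ?_
    have h4 : inner ℝ z.2 (EuclideanSpace.single i (1 : ℝ)) = z.2 i := by
      rw [EuclideanSpace.inner_single_right]; simp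
    simp [spaceDir, η₀, h4]
    ring
  have hpos : 0 < ∫ z, η₀ z := by
    -- The mean value theorem gives `v` with `B'(v) = -2`. At time `1/2` and a point with `|y|² = v`
    -- the kernel equals `4`, so its integral is positive; `0 < d` ensures that such a point exists.
    obtain ⟨v, hv, hv'⟩ := exists_deriv_eq_slope B one_half_pos
      hB.continuous.continuousOn (hB.differentiable (by simp)).differentiableOn
    rw [hBzero _ le_rfl, hB0] at hv'
    refine hη₀.smooth.continuous.integral_pos_of_hasCompactSupport_nonneg_nonzero
      hη₀.hasCompactSupport hη₀nn (x := (1 / 2, EuclideanSpace.single ⟨0, hd⟩ (√v))) ?_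
    have e1 : a (1 / 2 : ℝ) = 1 := a.one_of_mem_closedBall (Metric.mem_closedBall_self a.rIn_pos.le)
    simp only [η₀, e1, PiLp.norm_single, Real.norm_eq_abs, sq_abs,
      Real.sq_sqrt hv.1.le, hv']
    norm_num
  set c := ∫ z, η₀ z
  have hscale : ∀ {f : SpaceTime d → ℝ}, IsUnitKernel f → IsUnitKernel fun z => c⁻¹ * f z :=
    fun {f} hf => ⟨contDiff_const.mul hf.smooth,
      (tsupport_mul_subset_right (f := fun _ => c⁻¹)).trans hf.tsupport_subset⟩
  have hη := hscale hη₀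
  refine ⟨fun z => c⁻¹ * η₀ z, fun z => -2 * z.1 * (c⁻¹ * η₀ z), fun z => c⁻¹ * ψ₀ z,
    ⟨hη.smooth, hη.hasCompactSupport, fun z => mul_nonneg (inv_nonneg.2 hpos.le) (hη₀nn z), ?_⟩,
    hη, ?_, hscale hψ₀, ?_⟩
  · rw [integral_const_mul, inv_mul_cancel₀ hpos.ne']
  · exact ⟨(contDiff_const.mul contDiff_fst).mul hη.smooth,
      (tsupport_mul_subset_right (f := fun z : SpaceTime d => -2 * z.1)).trans hη.tsupport_subset⟩
  · funext z
    refine eulerOp_eq_of_gradient hη.smooth (fun i z => ?_) z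
    have := ((hψ₀.smooth.differentiable (by simp) z).hasFDerivAt.const_mul c⁻¹).fderiv
    refine (congrArg (· (spaceDir i)) this).trans ?_
    have h := hgrad i z
    rw [dirDeriv] at h
    simp only [smul_apply, smul_eq_mul, h]
    ring

end KernelIdentity

/-! ### Dyadic differences of the special mollifications. -/

section ScaleDifference
variable {d : ℕ}

theorem enorm_sub_le_of_hasDerivAt {f f' : ℝ → ℝ} {a b : ℝ} (hab : a ≤ b) {B : ℝ≥0∞}
    (hf : ∀ σ ∈ Set.Icc a b, HasDerivAt f (f' σ) σ) (hB : ∀ σ ∈ Set.Icc a b, ‖f' σ‖ₑ ≤ B) :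
    ‖f b - f a‖ₑ ≤ B * ENNReal.ofReal (b - a) := by
  rcases hab.eq_or_lt with rfl | hlt
  · simp
  rcases eq_or_ne B ⊤ with rfl | hBt
  · rw [ENNReal.top_mul (by simpa using hlt)]; exact le_top
  have h := (convex_Icc a b).norm_image_sub_le_of_norm_hasDerivWithin_le (C := B.toReal)
    (fun σ hσ => (hf σ hσ).hasDerivWithinAt) (fun σ hσ => by
      rw [← toReal_enorm]
      exact ENNReal.toReal_mono hBt (hB σ hσ)) (Set.left_mem_Icc.2 hab) (Set.right_mem_Icc.2 hab)
  rw [Real.norm_of_nonneg (sub_nonneg.2 hab)] at h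
  rw [← ofReal_norm]
  refine (ENNReal.ofReal_le_ofReal h).trans_eq ?_
  rw [ENNReal.ofReal_mul ENNReal.toReal_nonneg, ENNReal.ofReal_toReal hBt]

theorem conv_finset_sum {ι : Type*} (S : Finset ι) {u : SpaceTime d → ℝ}
    (hu : LocallyIntegrable u volume) {κ : ι → SpaceTime d → ℝ} (hκ : ∀ i, Continuous (κ i))
    (hc : ∀ i, HasCompactSupport (κ i)) (z : SpaceTime d) :
    conv u (fun w => ∑ i ∈ S, κ i w) z = ∑ i ∈ S, conv u (κ i) z := by
  simp only [conv, convolution_def, ContinuousLinearMap.mul_apply', Finset.mul_sum]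
  exact integral_finsetSum _ fun i _ => (hc i).convolutionExists_right
    (ContinuousLinearMap.mul ℝ ℝ) hu (hκ i) z

theorem dirDeriv_conv_parRescale {u κ : SpaceTime d → ℝ} (hu : LocallyIntegrable u volume)
    (hκ : IsUnitKernel κ) {s : ℝ} (hs : 0 < s) (j : Fin d) :
    dirDeriv (spaceDir j) (conv u (parRescale κ s)) =
      fun z => s⁻¹ * conv u (parRescale (dirDeriv (spaceDir j) κ) s) z := by
  rw [dirDeriv_conv hu (contDiff_parRescale hκ.smooth s)
    (hasCompactSupport_parRescale hκ.hasCompactSupport hs), dirDeriv_space_parRescale hκ.smooth hs]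
  funext z
  rw [conv_const_mul, ← mul_assoc, inv_mul_cancel₀ hs.ne', one_mul]

theorem contDiff_conv {u κ : SpaceTime d → ℝ} (hu : LocallyIntegrable u volume)
    (hκ : ContDiff ℝ ∞ κ) (hc : HasCompactSupport κ) : ContDiff ℝ ∞ (conv u κ) :=
  hc.contDiff_convolution_right (n := ⊤) _ hu hκ

/-- The right-hand side of the scale derivative of a heat kernel mollification. -/
noncomputable def heatConv (θ ψ : SpaceTime d → ℝ) (f : SpaceTime d → ℝ)
    (g : SpaceTime d → EuclideanSpace ℝ (Fin d × Fin d)) (s : ℝ) (z : SpaceTime d) : ℝ :=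
  conv f (parRescale θ s) z + ∑ i, conv (fun w => g w (i, i)) (parRescale ψ s) z

theorem exists_enorm_heatConv_le {θ ψ : SpaceTime d → ℝ} (hθ : IsUnitKernel θ)
    (hψ : IsUnitKernel ψ) : ∃ C : ℝ≥0, ∀ (f : SpaceTime d → ℝ)
      (g : SpaceTime d → EuclideanSpace ℝ (Fin d × Fin d)) (s : ℝ), 0 < s → ∀ z,
      ‖heatConv θ ψ f g s z‖ₑ ≤
        C * (cylMean s (fun w => ‖f w‖ₑ) z + cylMean s (fun w => ‖g w‖ₑ) z) := by
  obtain ⟨A, hA⟩ := hθ.exists_bound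
  obtain ⟨B, hB⟩ := hψ.exists_bound
  refine ⟨A + d * B, fun f g s hs z => ?_⟩
  have h1 := enorm_conv_parRescale_le hθ hA hs f z
  have h2 : ∀ i, ‖conv (fun w => g w (i, i)) (parRescale ψ s) z‖ₑ ≤
      B * cylMean s (fun w => ‖g w‖ₑ) z := fun i =>
    (enorm_conv_parRescale_le hψ hB hs _ z).trans <| by
      gcongr
      exact cylMean_mono (fun w => by
        rw [← ofReal_norm, ← ofReal_norm]
        exact ENNReal.ofReal_le_ofReal (PiLp.norm_apply_le (g w) (i, i))) z
  calc ‖heatConv θ ψ f g s z‖ₑ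
      ≤ ‖conv f (parRescale θ s) z‖ₑ +
        ∑ i, ‖conv (fun w => g w (i, i)) (parRescale ψ s) z‖ₑ :=
        (enorm_add_le _ _).trans (by gcongr; exact enorm_sum_le _ _)
    _ ≤ A * cylMean s (fun w => ‖f w‖ₑ) z +
        ∑ _i : Fin d, B * cylMean s (fun w => ‖g w‖ₑ) z := by
        gcongr with i
        exact h2 i
    _ ≤ _ := by
        rw [Finset.sum_const, Finset.card_univ, Fintype.card_fin, nsmul_eq_mul, mul_add,
          ← mul_assoc]
        push_cast
        gcongr
        · exact le_self_add
        · exact le_add_self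

variable {u ut : SpaceTime d → ℝ} {Du : SpaceTime d → EuclideanSpace ℝ (Fin d)}
  {D2u : SpaceTime d → EuclideanSpace ℝ (Fin d × Fin d)} {η θ ψ : SpaceTime d → ℝ}

/-- A time derivative of a rescaled kernel costs `s^(-2)`, and so do two space derivatives. The
kernel identity is therefore parabolically homogeneous, and moving the derivatives onto `u` produces
the common factor `s²`. -/
theorem conv_eulerOp (hK : IsHeatKernel η θ ψ) (ht : HasWeakDeriv (timeDir d) u ut)
    (hx : ∀ i, HasWeakDeriv (spaceDir i) u (fun z => Du z i))
    (hxx : ∀ i j, HasWeakDeriv (spaceDir j) (fun z => Du z i) (fun z => D2u z (i, j)))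
    {s : ℝ} (hs : 0 < s) :
    conv u (parRescale (eulerOp η) s) = fun z => s ^ 2 * heatConv θ ψ ut D2u s z := by
  have hθs := contDiff_parRescale hK.kernel_time.smooth s
  have hψs := contDiff_parRescale hK.kernel_space.smooth s
  have hθc := hasCompactSupport_parRescale hK.kernel_time.hasCompactSupport hs
  have hψc := hasCompactSupport_parRescale hK.kernel_space.hasCompactSupport hs
  have hψ2 : ∀ i, IsUnitKernel (dirDeriv (spaceDir i) (dirDeriv (spaceDir i) ψ)) := fun i =>
    (hK.kernel_space.dirDeriv _).dirDeriv _
  have hc2 : ∀ i, HasCompactSupport (parRescale (dirDeriv (spaceDir i) (dirDeriv (spaceDir i) ψ)) s) :=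
    fun i => hasCompactSupport_parRescale (hψ2 i).hasCompactSupport hs
  have e1 : parRescale (eulerOp η) s = fun w => parRescale (dirDeriv (timeDir d) θ) s w +
      ∑ i, parRescale (dirDeriv (spaceDir i) (dirDeriv (spaceDir i) ψ)) s w := by
    funext w
    simp only [parRescale, hK.euler_eq, mul_add, Finset.mul_sum]
  have e2 : conv u (parRescale (dirDeriv (timeDir d) θ) s) =
      fun z => s ^ 2 * conv ut (parRescale θ s) z := by
    rw [dirDeriv_timeDir_parRescale hK.kernel_time.smooth hs]
    funext z
    rw [conv_const_mul, conv_dirDeriv ht hθs hθc]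
  have e3 : ∀ i z, conv u (parRescale (dirDeriv (spaceDir i) (dirDeriv (spaceDir i) ψ)) s) z =
      s ^ 2 * conv (fun w => D2u w (i, i)) (parRescale ψ s) z := fun i z => by
    have hψ1 := hK.kernel_space.dirDeriv (spaceDir i)
    rw [dirDeriv_space_parRescale hψ1.smooth hs, conv_const_mul,
      conv_dirDeriv (hx i) (contDiff_parRescale hψ1.smooth s)
        (hasCompactSupport_parRescale hψ1.hasCompactSupport hs),
      dirDeriv_space_parRescale hK.kernel_space.smooth hs, conv_const_mul,
      conv_dirDeriv (hxx i i) hψs hψc]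
    ring
  -- By the kernel identity the sum of second derivatives equals `eulerOp η - ∂_t θ`, a difference
  -- of two unit kernels.
  have hcs : HasCompactSupport fun w => ∑ i,
      parRescale (dirDeriv (spaceDir i) (dirDeriv (spaceDir i) ψ)) s w := by
    have : IsUnitKernel fun w => eulerOp η w - dirDeriv (timeDir d) θ w :=
      ⟨hK.kernel.eulerOp.smooth.sub (hK.kernel_time.dirDeriv _).smooth,
        (tsupport_sub _ _).trans (Set.union_subset hK.kernel.eulerOp.tsupport_subset
          (hK.kernel_time.dirDeriv _).tsupport_subset)⟩
    convert! hasCompactSupport_parRescale this.hasCompactSupport hs using 1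
    funext w
    simp only [parRescale, hK.euler_eq, add_sub_cancel_left, Finset.mul_sum]
  rw [e1, conv_add ht.1
    (contDiff_parRescale (hK.kernel_time.dirDeriv _).smooth s).continuous
    (hasCompactSupport_parRescale (hK.kernel_time.dirDeriv _).hasCompactSupport hs)
    (continuous_finsetSum _ fun i _ => (contDiff_parRescale (hψ2 i).smooth s).continuous) hcs]
  funext z
  rw [e2, conv_finset_sum _ ht.1 (fun i => (contDiff_parRescale (hψ2 i).smooth s).continuous) hc2,
    Finset.sum_congr rfl fun i _ => e3 i z, heatConv, mul_add, Finset.mul_sum]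

/-- The scale derivative of `u * η_σ` is `σ` times a convolution of `∂_t u` and `D²u`; integrating
over `[s/2, s]` supplies the second factor `s`. -/
theorem exists_mollify_sub_le (hK : IsHeatKernel η θ ψ) :
    ∃ C : ℝ≥0, ∀ (u ut : SpaceTime d → ℝ) (Du : SpaceTime d → EuclideanSpace ℝ (Fin d))
      (D2u : SpaceTime d → EuclideanSpace ℝ (Fin d × Fin d)),
      HasWeakDeriv (timeDir d) u ut → (∀ i, HasWeakDeriv (spaceDir i) u (fun z => Du z i)) →
      (∀ i j, HasWeakDeriv (spaceDir j) (fun z => Du z i) (fun z => D2u z (i, j))) →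
      ∀ s : ℝ, 0 < s → ∀ z, ‖mollify η s u z - mollify η (s / 2) u z‖ₑ ≤
        C * ENNReal.ofReal s ^ (2 : ℝ) *
          (cylMean s (fun w => ‖ut w‖ₑ) z + cylMean s (fun w => ‖D2u w‖ₑ) z) := by
  obtain ⟨C, hC⟩ := exists_enorm_heatConv_le hK.kernel_time hK.kernel_space
  refine ⟨C * 2 ^ (d + 2), fun u ut Du D2u ht hx hxx s hs z => ?_⟩
  set S := cylMean s (fun w => ‖ut w‖ₑ) z + cylMean s (fun w => ‖D2u w‖ₑ) z with hS
  have h := enorm_sub_le_of_hasDerivAt (f := fun σ => mollify η σ u z)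
    (f' := fun σ => σ * heatConv θ ψ ut D2u σ z) (by linarith : s / 2 ≤ s)
    (B := ENNReal.ofReal s * (C * (2 ^ (d + 2) * S))) (fun σ hσ => ?_) (fun σ hσ => ?_)
  · refine h.trans ?_
    calc _ ≤ ENNReal.ofReal s * (C * (2 ^ (d + 2) * S)) * ENNReal.ofReal s := by
          gcongr; linarith
      _ = _ := by
          rw [ENNReal.rpow_two]; push_cast; ring
  · have hσ0 : 0 < σ := by linarith [hσ.1]
    have := hasDerivAt_conv_parRescale ht.1 hK.kernel hσ0 z
    rw [conv_eulerOp hK ht hx hxx hσ0] at this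
    convert! this using 1
    field_simp
  · have hσ0 : 0 < σ := by linarith [hσ.1]
    rw [enorm_mul, Real.enorm_of_nonneg hσ0.le]
    gcongr
    · exact hσ.2
    · refine (hC ut D2u σ hσ0 z).trans ?_
      rw [hS, mul_add (2 ^ (d + 2))]
      gcongr <;> exact cylMean_le_two_pow hσ0 hσ.1 hσ.2 _ z

/-- The extra derivative falls on `θ` and `ψ` and costs one power of the scale, so the scale
derivative carries no power of `σ` and integration gives a single factor `s`. -/
theorem exists_dirDeriv_mollify_sub_le (hK : IsHeatKernel η θ ψ) (j : Fin d) :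
    ∃ C : ℝ≥0, ∀ (u ut : SpaceTime d → ℝ) (Du : SpaceTime d → EuclideanSpace ℝ (Fin d))
      (D2u : SpaceTime d → EuclideanSpace ℝ (Fin d × Fin d)),
      HasWeakDeriv (timeDir d) u ut → (∀ i, HasWeakDeriv (spaceDir i) u (fun z => Du z i)) →
      (∀ i j, HasWeakDeriv (spaceDir j) (fun z => Du z i) (fun z => D2u z (i, j))) →
      ∀ s : ℝ, 0 < s → ∀ z,
        ‖dirDeriv (spaceDir j) (mollify η s u) z -
          dirDeriv (spaceDir j) (mollify η (s / 2) u) z‖ₑ ≤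
        C * ENNReal.ofReal s ^ (1 : ℝ) *
          (cylMean s (fun w => ‖ut w‖ₑ) z + cylMean s (fun w => ‖D2u w‖ₑ) z) := by
  have hθj := hK.kernel_time.dirDeriv (spaceDir j)
  have hψj := hK.kernel_space.dirDeriv (spaceDir j)
  have hηj := hK.kernel.dirDeriv (spaceDir j)
  obtain ⟨C, hC⟩ := exists_enorm_heatConv_le hθj hψj
  refine ⟨C * 2 ^ (d + 2), fun u ut Du D2u ht hx hxx s hs z => ?_⟩
  set S := cylMean s (fun w => ‖ut w‖ₑ) z + cylMean s (fun w => ‖D2u w‖ₑ) z with hS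
  have hE : ∀ σ, 0 < σ → dirDeriv (spaceDir j) (mollify η σ u) z =
      σ⁻¹ * conv u (parRescale (dirDeriv (spaceDir j) η) σ) z := fun σ hσ =>
    congrFun (dirDeriv_conv_parRescale ht.1 hK.kernel hσ j) z
  rw [hE s hs, hE (s / 2) (by linarith)]
  have h := enorm_sub_le_of_hasDerivAt
    (f := fun σ => σ⁻¹ * conv u (parRescale (dirDeriv (spaceDir j) η) σ) z)
    (f' := fun σ => heatConv (dirDeriv (spaceDir j) θ) (dirDeriv (spaceDir j) ψ) ut D2u σ z)
    (by linarith : s / 2 ≤ s)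
    (B := C * (2 ^ (d + 2) * S)) (fun σ hσ => ?_) (fun σ hσ => ?_)
  · refine h.trans ?_
    calc _ ≤ (C * (2 ^ (d + 2) * S)) * ENNReal.ofReal s := by
          gcongr; linarith
      _ = _ := by
          rw [ENNReal.rpow_one]; push_cast; ring
  · have hσ0 : 0 < σ := by linarith [hσ.1]
    have h1 := (hasDerivAt_inv hσ0.ne').mul (hasDerivAt_conv_parRescale ht.1 hηj hσ0 z)
    convert! h1 using 1
    -- The commutator term of `dirDeriv_eulerOp` cancels the term coming from differentiating the
    -- prefactor `σ⁻¹`.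
    have hsub : conv u (parRescale (eulerOp (dirDeriv (spaceDir j) η)) σ) z =
        conv u (parRescale (dirDeriv (spaceDir j) (eulerOp η)) σ) z +
          conv u (parRescale (dirDeriv (spaceDir j) η) σ) z := by
      have hej := hK.kernel.eulerOp.dirDeriv (spaceDir j)
      have := congrFun (conv_add ht.1 (contDiff_parRescale hej.smooth σ).continuous
        (hasCompactSupport_parRescale hej.hasCompactSupport hσ0)
        (contDiff_parRescale hηj.smooth σ).continuous
        (hasCompactSupport_parRescale hηj.hasCompactSupport hσ0)) z
      rw [← this]
      congr 1
      funext w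
      simp only [parRescale, dirDeriv_eulerOp hK.kernel.smooth]
      ring
    have hmain : σ⁻¹ * conv u (parRescale (dirDeriv (spaceDir j) (eulerOp η)) σ) z =
        σ * heatConv (dirDeriv (spaceDir j) θ) (dirDeriv (spaceDir j) ψ) ut D2u σ z := by
      rw [← congrFun (dirDeriv_conv_parRescale ht.1 hK.kernel.eulerOp hσ0 j) z,
        conv_eulerOp hK ht hx hxx hσ0]
      have hd1 : ∀ {f κ : SpaceTime d → ℝ}, LocallyIntegrable f volume → IsUnitKernel κ →
          HasFDerivAt (conv f (parRescale κ σ)) (fderiv ℝ (conv f (parRescale κ σ)) z) z :=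
        fun hf hκ => ((contDiff_conv hf (contDiff_parRescale hκ.smooth σ)
          (hasCompactSupport_parRescale hκ.hasCompactSupport hσ0)).differentiable
            (by simp) z).hasFDerivAt
      have h2 := ((hd1 ht.2.1 hK.kernel_time).add (HasFDerivAt.fun_sum (u := Finset.univ)
        fun i _ => hd1 (hxx i i).2.1 hK.kernel_space)).const_mul (σ ^ 2)
      have h3 : ∀ {f κ : SpaceTime d → ℝ}, LocallyIntegrable f volume → IsUnitKernel κ →
          fderiv ℝ (conv f (parRescale κ σ)) z (spaceDir j) =
            σ⁻¹ * conv f (parRescale (dirDeriv (spaceDir j) κ) σ) z := fun hf hκ =>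
        congrFun (dirDeriv_conv_parRescale hf hκ hσ0 j) z
      refine (congrArg (· (spaceDir j)) h2.fderiv).trans ?_
      simp only [smul_apply, add_apply, sum_apply, smul_eq_mul, heatConv, h3 ht.2.1 hK.kernel_time,
        h3 (hxx _ _).2.1 hK.kernel_space]
      rw [← Finset.mul_sum]
      field_simp
    rw [hsub]
    field_simp at hmain ⊢
    linear_combination -hmain
  · have hσ0 : 0 < σ := by linarith [hσ.1]
    refine (hC ut D2u σ hσ0 z).trans ?_
    rw [hS, mul_add (2 ^ (d + 2))]
    gcongr <;> exact cylMean_le_two_pow hσ0 hσ.1 hσ.2 _ z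

end ScaleDifference

/-! ### Algebra of convolutions and convergence of general mollifications. -/

section Mollification
variable {d : ℕ}

theorem conv_comm (κ κ' : SpaceTime d → ℝ) : conv κ κ' = conv κ' κ := by
  unfold conv
  rw [← convolution_flip]
  congr 1
  ext
  simp

theorem conv_assoc {u κ κ' : SpaceTime d → ℝ} (hu : LocallyIntegrable u volume)
    (hκ : Continuous κ) (hc : HasCompactSupport κ) (hκ' : Continuous κ')
    (hc' : HasCompactSupport κ') : conv (conv u κ) κ' = conv u (conv κ κ') := by
  funext z
  refine convolution_assoc _ _ _ _ (fun x y z => mul_assoc x y z) hu.aestronglyMeasurable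
    hκ.aestronglyMeasurable hκ'.aestronglyMeasurable ?_ ?_ ?_
  · exact Eventually.of_forall fun y => hc.convolutionExists_right _ hu hκ y
  · exact Eventually.of_forall fun y =>
      hc'.norm.convolutionExists_right _ hκ.norm.locallyIntegrable hκ'.norm y
  · have hu' : LocallyIntegrable (fun x => ‖u x‖) volume := fun x =>
      let ⟨s, hs, h⟩ := hu x; ⟨s, hs, h.norm⟩
    have h1 : HasCompactSupport (conv (fun x => ‖κ x‖) (fun x => ‖κ' x‖)) :=
      HasCompactSupport.convolution (μ := volume) (ContinuousLinearMap.mul ℝ ℝ) hc.norm hc'.norm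
    have h2 : Continuous (conv (fun x => ‖κ x‖) (fun x => ‖κ' x‖)) :=
      continuous_conv hκ.norm.locallyIntegrable hκ'.norm hc'.norm
    exact h1.convolutionExists_right (ContinuousLinearMap.mul ℝ ℝ) hu' h2 z

theorem conv_dirDeriv_comm {κ κ' : SpaceTime d → ℝ} (hκ : ContDiff ℝ ∞ κ)
    (hc : HasCompactSupport κ) (hκ' : ContDiff ℝ ∞ κ') (hc' : HasCompactSupport κ')
    (v : SpaceTime d) : conv (dirDeriv v κ) κ' = conv (dirDeriv v κ') κ := by
  rw [conv_comm, ← dirDeriv_conv hκ'.continuous.locallyIntegrable hκ hc, conv_comm,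
    dirDeriv_conv hκ.continuous.locallyIntegrable hκ' hc', conv_comm]

namespace IsMollifier
variable {ζ : SpaceTime d → ℝ}

theorem parRescale (hζ : IsMollifier ζ) {ε : ℝ} (hε : 0 < ε) : IsMollifier (parRescale ζ ε) where
  smooth := contDiff_parRescale hζ.smooth ε
  compact := hasCompactSupport_parRescale hζ.compact hε
  nonneg z := mul_nonneg (by positivity) (hζ.nonneg _)
  integral_eq_one := by
    have hint : Integrable ζ volume := hζ.smooth.continuous.integrable_of_hasCompactSupport hζ.compact
    have hc := hasCompactSupport_parRescale hζ.compact hε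
    have hcont := (contDiff_parRescale hζ.smooth ε).continuous
    have h1 := integral_prod (μ := (volume : Measure ℝ)) (ν := (volume : Measure (Space d))) _
      (hcont.integrable_of_hasCompactSupport hc (μ := volume))
    have h2 := integral_prod (μ := (volume : Measure ℝ)) (ν := (volume : Measure (Space d))) _ hint
    rw [← Measure.volume_eq_prod] at h1 h2
    have hone := hζ.integral_eq_one
    rw [h2] at hone
    rw [h1]
    simp only [_root_.parRescale, integral_const_mul]
    have h3 : ∀ t : ℝ, ∫ x : Space d, ζ (t, ε⁻¹ • x) = ε ^ d * ∫ x : Space d, ζ (t, x) :=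
      fun t => by
        rw [Measure.integral_comp_smul volume (fun x : Space d => ζ (t, x)) ε⁻¹]
        simp [abs_of_pos hε]
    simp only [h3, integral_const_mul]
    rw [Measure.integral_comp_div (fun t => ∫ x : Space d, ζ (t, x)) (ε ^ 2), hone,
      abs_of_pos (by positivity)]
    simp only [smul_eq_mul, mul_one]
    field_simp
    ring

theorem lintegral_eq_one (hζ : IsMollifier ζ) : ∫⁻ z, ENNReal.ofReal (ζ z) = 1 := by
  rw [← ofReal_integral_eq_lintegral_ofReal
    (hζ.smooth.continuous.integrable_of_hasCompactSupport hζ.compact)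
    (Eventually.of_forall hζ.nonneg), hζ.integral_eq_one, ENNReal.ofReal_one]

theorem eventually_support_subset (hζ : IsMollifier ζ) {R : ℝ} (hR : 0 < R) :
    ∀ᶠ ε in 𝓝[>] (0 : ℝ), Function.support (_root_.parRescale ζ ε) ⊆ Metric.ball 0 R := by
  obtain ⟨M, hM⟩ := hζ.compact.isCompact.isBounded.exists_norm_le
  have h1 : ∀ᶠ ε in 𝓝[>] (0 : ℝ), ε * (|M| + 1) < R := by
    have : Tendsto (fun ε : ℝ => ε * (|M| + 1)) (𝓝[>] 0) (𝓝 (0 * (|M| + 1))) :=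
      (tendsto_id.mul_const _).mono_left nhdsWithin_le_nhds
    rw [zero_mul] at this
    exact this.eventually (gt_mem_nhds hR)
  -- Requiring `ε < 1` gives `ε² ≤ ε`, so the time extent obeys the same bound as the space extent.
  filter_upwards [h1, self_mem_nhdsWithin, Ioo_mem_nhdsGT one_pos] with ε h2 hε h3 z hz
  have hε0 : 0 < ε := hε
  have h4 := hM _ (subset_tsupport ζ (right_ne_zero_of_mul hz))
  rw [Prod.norm_def, max_le_iff] at h4
  simp only [norm_smul, norm_inv, norm_div, norm_pow, Real.norm_of_nonneg hε0.le] at h4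
  rw [div_le_iff₀ (by positivity), inv_mul_le_iff₀ hε0] at h4
  rw [mem_ball_zero_iff, Prod.norm_def, max_lt_iff]
  have hMle := le_abs_self M
  constructor
  · refine lt_of_le_of_lt h4.1 (lt_of_le_of_lt ?_ h2)
    have : M * ε ^ 2 ≤ (|M| + 1) * ε ^ 2 := by gcongr; linarith
    refine this.trans ?_
    rw [mul_comm ε]
    gcongr
    nlinarith [h3.2]
  · refine lt_of_le_of_lt h4.2 (lt_of_le_of_lt ?_ h2)
    gcongr
    linarith

/-- Mollifications of a continuous function converge uniformly on compact sets. -/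
theorem eventually_dist_mollify_le (hζ : IsMollifier ζ) {W : SpaceTime d → ℝ} (hW : Continuous W)
    {K : Set (SpaceTime d)} (hK : IsCompact K) {c : ℝ} (hc : 0 < c) :
    ∀ᶠ ε in 𝓝[>] (0 : ℝ), ∀ z ∈ K, |mollify ζ ε W z - W z| ≤ c := by
  have hu := hK.uniformContinuousAt_of_continuousAt W (fun _ _ => hW.continuousAt)
    (Metric.dist_mem_uniformity hc)
  obtain ⟨R, hR, hRu⟩ := Metric.mem_uniformity_dist.1 hu
  filter_upwards [hζ.eventually_support_subset hR, self_mem_nhdsWithin] with ε h1 hε z hz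
  have hm := hζ.parRescale hε
  have h2 : mollify ζ ε W z =
      convolution (_root_.parRescale ζ ε) W (ContinuousLinearMap.lsmul ℝ ℝ) volume z := by
    rw [convolution_lsmul_swap, mollify, convolution_def]
    congr 1
    ext w
    simp [mul_comm]
  rw [h2, ← Real.dist_eq]
  refine dist_convolution_le hc.le h1 hm.nonneg hm.integral_eq_one hW.aestronglyMeasurable
    fun y hy => ?_
  rw [dist_comm]
  refine (hRu (a := z) (b := y) ?_ hz).le
  rwa [dist_comm]

theorem tendsto_mollify (hζ : IsMollifier ζ) {W : SpaceTime d → ℝ} (hW : Continuous W)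
    (z : SpaceTime d) : Tendsto (fun ε => mollify ζ ε W z) (𝓝[>] 0) (𝓝 (W z)) := by
  rw [Metric.tendsto_nhds]
  intro c hc
  filter_upwards [hζ.eventually_dist_mollify_le hW (isCompact_singleton (x := z)) (half_pos hc)]
    with ε h
  rw [Real.dist_eq]
  linarith [h z rfl]

theorem enorm_mollify_le (ζ : SpaceTime d → ℝ) (hζ : ∀ z, 0 ≤ ζ z) {ε : ℝ} (hε : 0 < ε)
    (f : SpaceTime d → ℝ) (z : SpaceTime d) :
    ‖mollify ζ ε f z‖ₑ ≤ ∫⁻ w, ‖f (z - w)‖ₑ * ENNReal.ofReal (_root_.parRescale ζ ε w) := by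
  rw [mollify, convolution_eq_swap]
  refine (enorm_integral_le_lintegral_enorm _).trans (lintegral_mono fun w => ?_)
  rw [ContinuousLinearMap.mul_apply', enorm_mul, Real.enorm_of_nonneg (r := _root_.parRescale ζ ε w)
    (mul_nonneg (by positivity) (hζ _))]

end IsMollifier

theorem mollify_sub {ζ : SpaceTime d → ℝ} (hζ : IsMollifier ζ) {ε : ℝ} (hε : 0 < ε)
    {f g : SpaceTime d → ℝ} (hf : Continuous f) (hg : Continuous g) (z : SpaceTime d) :
    mollify ζ ε (fun w => f w - g w) z = mollify ζ ε f z - mollify ζ ε g z := by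
  have hm := hζ.parRescale hε
  simp only [mollify, convolution_def, ContinuousLinearMap.mul_apply', sub_mul]
  exact integral_sub
    (hm.compact.convolutionExists_right (ContinuousLinearMap.mul ℝ ℝ) hf.locallyIntegrable
      hm.smooth.continuous z)
    (hm.compact.convolutionExists_right (ContinuousLinearMap.mul ℝ ℝ) hg.locallyIntegrable
      hm.smooth.continuous z)

theorem mollify_eq_conv (ζ : SpaceTime d → ℝ) (ε : ℝ) (u : SpaceTime d → ℝ) :
    mollify ζ ε u = conv u (parRescale ζ ε) := rfl

/-- Exchanging the order lets `s ↓ 0` be taken at fixed `ε`: the right-hand side mollifies the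
smooth function `u * ζ_ε`, and so tends to it. -/
theorem mollify_mollify {ζ η u : SpaceTime d → ℝ} (hζ : IsMollifier ζ) (hη : IsMollifier η)
    (hu : LocallyIntegrable u volume) {ε s : ℝ} (hε : 0 < ε) (hs : 0 < s) :
    mollify ζ ε (mollify η s u) = mollify η s (mollify ζ ε u) := by
  have h1 := hζ.parRescale hε
  have h2 := hη.parRescale hs
  simp only [mollify_eq_conv]
  rw [conv_assoc hu h2.smooth.continuous h2.compact h1.smooth.continuous h1.compact, conv_comm
    (parRescale η s), ← conv_assoc hu h1.smooth.continuous h1.compact h2.smooth.continuous h2.compact]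

theorem mollify_dirDeriv_mollify {ζ η u : SpaceTime d → ℝ} (hζ : IsMollifier ζ)
    (hη : IsMollifier η) (hu : LocallyIntegrable u volume) {ε s : ℝ} (hε : 0 < ε) (hs : 0 < s)
    (v : SpaceTime d) :
    mollify ζ ε (dirDeriv v (mollify η s u)) = mollify η s (dirDeriv v (mollify ζ ε u)) := by
  have h1 := hζ.parRescale hε
  have h2 := hη.parRescale hs
  simp only [mollify_eq_conv]
  rw [dirDeriv_conv hu h2.smooth h2.compact, dirDeriv_conv hu h1.smooth h1.compact,
    conv_assoc hu (contDiff_dirDeriv h2.smooth v).continuous (h2.compact.dirDeriv v)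
      h1.smooth.continuous h1.compact,
    conv_assoc hu (contDiff_dirDeriv h1.smooth v).continuous (h1.compact.dirDeriv v)
      h2.smooth.continuous h2.compact, conv_dirDeriv_comm h2.smooth h2.compact h1.smooth h1.compact]

theorem tendsto_div_two_pow {s : ℝ} (hs : 0 < s) :
    Tendsto (fun k : ℕ => s / 2 ^ k) atTop (𝓝[>] 0) := by
  refine tendsto_nhdsWithin_iff.2 ⟨?_, Eventually.of_forall fun k => Set.mem_Ioi.2 (by positivity)⟩
  exact tendsto_const_nhds.div_atTop (tendsto_pow_atTop_atTop_of_one_lt one_lt_two)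

end Mollification

/-! ### Telescoping and geometric series in `L_r`. -/

section Telescoping

/-- Pointwise the distance to the limit is at most the sum of the increments; the `L_r` norm of that
sum is handled by Minkowski with counting measure on the scales. -/
theorem eLpNorm_sub_le_tsum {X : Type*} [MeasurableSpace X] {μ : Measure X} [SFinite μ] {r : ℝ}
    (hr : 1 < r) {F : ℕ → X → ℝ} {f : X → ℝ} {H : ℕ → X → ℝ≥0∞} (hH : ∀ k, Measurable (H k))
    (hF : ∀ᵐ x ∂μ, Tendsto (fun k => F k x) atTop (𝓝 (f x)))
    (hFH : ∀ k x, ‖F k x - F (k + 1) x‖ₑ ≤ H k x) :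
    eLpNorm (fun x => f x - F 0 x) (ENNReal.ofReal r) μ ≤
      ∑' k, (∫⁻ x, H k x ^ r ∂μ) ^ (1 / r) := by
  have hr0 : 0 < r := by linarith
  rw [eLpNorm_eq_lintegral_rpow_enorm_toReal (by simpa using hr0) ENNReal.ofReal_ne_top,
    ENNReal.toReal_ofReal hr0.le]
  have hmeas : Measurable (Function.uncurry fun (x : X) (k : ℕ) => H k x) :=
    measurable_from_prod_countable_left fun k => hH k
  have hM := lintegral_lintegral_rpow_le (μ := μ) (ν := (Measure.count : Measure ℕ)) hr hmeas
  simp only [lintegral_count] at hM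
  refine le_trans (ENNReal.rpow_le_rpow (lintegral_mono_ae ?_) (by positivity)) hM
  filter_upwards [hF] with x hx
  refine ENNReal.rpow_le_rpow ?_ hr0.le
  have := edist_le_tsum_of_edist_le_of_tendsto₀ (fun k => H k x)
    (fun k => by rw [edist_eq_enorm_sub]; exact hFH k x) hx
  rwa [edist_comm, edist_eq_enorm_sub] at this

/-- The sum of the geometric series of ratio `2 ^ (-δ)`. -/
noncomputable def geomConst (δ : ℝ) : ℝ≥0∞ := (1 - 2 ^ (-δ))⁻¹

theorem geomConst_ne_top {δ : ℝ} (hδ : 0 < δ) : geomConst δ ≠ ⊤ := by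
  have : (2 : ℝ≥0∞) ^ (-δ) < 1 := ENNReal.rpow_lt_one_of_one_lt_of_neg ENNReal.one_lt_two (by linarith)
  rw [geomConst, ENNReal.inv_ne_top]
  exact tsub_eq_zero_iff_le.not.2 (not_le.2 this)

theorem tsum_ofReal_div_two_pow (δ s : ℝ) :
    ∑' k : ℕ, ENNReal.ofReal (s / 2 ^ k) ^ δ = geomConst δ * ENNReal.ofReal s ^ δ := by
  have : ∀ k : ℕ, ENNReal.ofReal (s / 2 ^ k) ^ δ =
      ENNReal.ofReal s ^ δ * (2 ^ (-δ)) ^ k := fun k => by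
    have h2 : (2 : ℝ≥0∞) ^ k ≠ 0 := by simp
    rw [ENNReal.ofReal_div_of_pos (by positivity), div_eq_mul_inv,
      ENNReal.mul_rpow_of_ne_top ENNReal.ofReal_ne_top
        (by simp), ENNReal.ofReal_pow (by norm_num), ENNReal.inv_rpow, ← ENNReal.rpow_natCast,
      ← ENNReal.rpow_natCast, ← ENNReal.rpow_mul, ← ENNReal.rpow_mul, ← ENNReal.rpow_neg]
    congr 2
    · simp
    · ring
  simp only [this]
  rw [ENNReal.tsum_mul_left, ENNReal.tsum_geometric, geomConst, mul_comm]

theorem tsum_bound_le {δ s : ℝ} {a : ℝ≥0∞}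
    {b : ℕ → ℝ≥0∞} (hb : ∀ k, b k ≤ a * ENNReal.ofReal (s / 2 ^ k) ^ δ) :
    ∑' k, b k ≤ geomConst δ * a * ENNReal.ofReal s ^ δ :=
  calc _ ≤ ∑' k : ℕ, a * ENNReal.ofReal (s / 2 ^ k) ^ δ := ENNReal.tsum_le_tsum hb
    _ = _ := by rw [ENNReal.tsum_mul_left, tsum_ofReal_div_two_pow δ s]; ring

theorem eLpNorm_add_sub_le {X : Type*} [MeasurableSpace X] {μ : Measure X} {p : ℝ≥0∞}
    (hp : 1 ≤ p) {a b c : X → ℝ} (ha : AEStronglyMeasurable a μ) (hb : AEStronglyMeasurable b μ)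
    (hc : AEStronglyMeasurable c μ) :
    eLpNorm (fun x => a x + (b x - c x)) p μ ≤ eLpNorm a p μ + (eLpNorm b p μ + eLpNorm c p μ) :=
  (eLpNorm_add_le ha (hb.sub hc) hp).trans (by gcongr; exact eLpNorm_sub_le hb hc hp)

end Telescoping

/-! ### Abstract trace theory for families of approximations indexed by scale. -/

section AbstractTrace
variable {d : ℕ}

/-- A family of approximations `E s` at scale `s`, whose dyadic differences are controlled in `L_r`
on balls of time slices with a gain `s ^ δ`. -/
structure IsScaleFamily (r δ : ℝ) (A : ℝ → ℝ≥0∞) (S : ℝ → SpaceTime d → ℝ≥0∞)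
    (E : ℝ → SpaceTime d → ℝ) : Prop where
  one_lt : 1 < r
  pos : 0 < δ
  finite : ∀ R, 0 < R → A R ≠ ⊤
  meas : ∀ s, Measurable (S s)
  cont : ∀ s, 0 < s → Continuous (E s)
  diff : ∀ s, 0 < s → ∀ z, ‖E s z - E (s / 2) z‖ₑ ≤ S s z
  bound : ∀ s R, 0 < s → s ≤ R → ∀ t x₀,
    (∫⁻ x in Metric.ball x₀ R, S s (t, x) ^ r) ^ (1 / r) ≤ A R * ENNReal.ofReal s ^ δ

namespace IsScaleFamily
variable {r δ : ℝ} {A : ℝ → ℝ≥0∞} {S : ℝ → SpaceTime d → ℝ≥0∞} {E : ℝ → SpaceTime d → ℝ}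

/-- The slice bound is uniform in the time and in the centre of the ball, hence survives averaging
over space-time translations by Minkowski. This is the source of uniformity in `ε`. -/
theorem lintegral_average_le (h : IsScaleFamily r δ A S E) {s R : ℝ} (hs : 0 < s) (hsR : s ≤ R)
    {φ : SpaceTime d → ℝ≥0∞} (hφ : Measurable φ) (hφ1 : ∫⁻ w, φ w = 1) (x₀ : Space d) :
    (∫⁻ x in Metric.ball x₀ R, (∫⁻ w, S s ((0, x) - w) * φ w) ^ r) ^ (1 / r) ≤
      A R * ENNReal.ofReal s ^ δ := by
  have hr0 : 0 < r := by linarith [h.one_lt]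
  have hmeas : Measurable (Function.uncurry fun (x : Space d) (w : SpaceTime d) =>
      S s ((0, x) - w) * φ w) :=
    ((h.meas s).comp (by fun_prop)).mul (hφ.comp measurable_snd)
  refine (lintegral_lintegral_rpow_le h.one_lt hmeas).trans ?_
  calc ∫⁻ w, (∫⁻ x in Metric.ball x₀ R, (S s ((0, x) - w) * φ w) ^ r) ^ (1 / r)
      ≤ ∫⁻ w, A R * ENNReal.ofReal s ^ δ * φ w := by
        refine lintegral_mono fun w => ?_
        have hm : Measurable fun x : Space d => S s ((0, x) - w) ^ r :=
          ((h.meas s).comp (by fun_prop)).pow_const r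
        have h1 : ∫⁻ x in Metric.ball x₀ R, S s ((0, x) - w) ^ r =
            ∫⁻ x in Metric.ball (x₀ - w.2) R, S s (-w.1, x) ^ r := by
          rw [← lintegral_indicator measurableSet_ball, ← lintegral_indicator measurableSet_ball,
            ← lintegral_sub_right_eq_self ((Metric.ball (x₀ - w.2) R).indicator _) w.2]
          refine lintegral_congr fun x => ?_
          have e : ((0, x) - w : SpaceTime d) = (-w.1, x - w.2) := Prod.ext (zero_sub _) rfl
          simp only [Set.indicator, Metric.mem_ball, dist_sub_right, e]
        simp only [ENNReal.mul_rpow_of_nonneg _ _ hr0.le]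
        rw [lintegral_mul_const _ hm, ENNReal.mul_rpow_of_nonneg _ _ (by positivity : 0 ≤ 1 / r),
          ← ENNReal.rpow_mul, mul_one_div_cancel hr0.ne', ENNReal.rpow_one, h1]
        gcongr
        exact h.bound s R hs hsR _ _
    _ = _ := by rw [lintegral_const_mul _ hφ, hφ1, mul_one]

theorem div_two_pow_succ (s : ℝ) (k : ℕ) : s / 2 ^ (k + 1) = s / 2 ^ k / 2 := by
  rw [pow_succ, div_div]

theorem div_two_pow_le {s R : ℝ} (hs : 0 < s) (hsR : s ≤ R) (k : ℕ) : s / 2 ^ k ≤ R :=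
  (div_le_self hs.le (one_le_pow₀ one_le_two)).trans hsR

theorem eLpNorm_sub_mollify_le (h : IsScaleFamily r δ A S E) {ζ : SpaceTime d → ℝ}
    (hζ : IsMollifier ζ) {ε : ℝ} (hε : 0 < ε) {P : SpaceTime d → ℝ} {s R : ℝ} (hs : 0 < s)
    (hsR : s ≤ R) (hP : ∀ z, Tendsto (fun k : ℕ => mollify ζ ε (E (s / 2 ^ k)) z) atTop (𝓝 (P z)))
    (x₀ : Space d) :
    eLpNorm (fun x => P (0, x) - mollify ζ ε (E s) (0, x)) (ENNReal.ofReal r)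
      (volume.restrict (Metric.ball x₀ R)) ≤ geomConst δ * A R * ENNReal.ofReal s ^ δ := by
  have hm := hζ.parRescale hε
  have hφ : Measurable fun w => ENNReal.ofReal (parRescale ζ ε w) :=
    hm.smooth.continuous.measurable.ennreal_ofReal
  have hsk : ∀ k : ℕ, 0 < s / 2 ^ k := fun k => by positivity
  have key := eLpNorm_sub_le_tsum (μ := volume.restrict (Metric.ball x₀ R)) h.one_lt
    (F := fun k x => mollify ζ ε (E (s / 2 ^ k)) (0, x)) (f := fun x => P (0, x))
    (H := fun k x => ∫⁻ w, S (s / 2 ^ k) ((0, x) - w) * ENNReal.ofReal (parRescale ζ ε w))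
    (fun k => Measurable.lintegral_prod_right (f := fun (x : Space d) (w : SpaceTime d) =>
      S (s / 2 ^ k) ((0, x) - w) * ENNReal.ofReal (parRescale ζ ε w))
      (((h.meas _).comp (by fun_prop)).mul (hφ.comp measurable_snd)))
    (Eventually.of_forall fun x => hP (0, x)) (fun k x => by
      rw [← mollify_sub hζ hε (h.cont _ (hsk k)) (h.cont _ (hsk _))]
      refine (IsMollifier.enorm_mollify_le ζ hζ.nonneg hε _ _).trans ?_
      gcongr with w
      rw [div_two_pow_succ]
      exact h.diff _ (hsk k) _)
  simp only [pow_zero, div_one] at key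
  exact key.trans (tsum_bound_le fun k =>
    h.lintegral_average_le (hsk k) (div_two_pow_le hs hsR k) hφ hm.lintegral_eq_one x₀)

/-- On each ball the sum of increments has finite `L_r` norm, and countably many balls cover the
space. -/
theorem ae_tsum_ne_top (h : IsScaleFamily r δ A S E) :
    ∀ᵐ x : Space d, ∑' k : ℕ, S (1 / 2 ^ k) (0, x) ≠ ⊤ := by
  have hr0 : 0 < r := by linarith [h.one_lt]
  have hSm : ∀ k : ℕ, Measurable fun x : Space d => S (1 / 2 ^ k) (0, x) := fun k =>
    (h.meas _).comp (by fun_prop)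
  have hball : ∀ n : ℕ, ∀ᵐ x ∂(volume.restrict (Metric.ball (0 : Space d) (n + 1))),
      ∑' k : ℕ, S (1 / 2 ^ k) (0, x) ≠ ⊤ := fun n => by
    have hn : (1 : ℝ) ≤ n + 1 := by linarith [n.cast_nonneg (α := ℝ)]
    have hmeas : Measurable (Function.uncurry fun (x : Space d) (k : ℕ) => S (1 / 2 ^ k) (0, x)) :=
      measurable_from_prod_countable_left hSm
    have hM := lintegral_lintegral_rpow_le (μ := volume.restrict (Metric.ball (0 : Space d) (n + 1)))
      (ν := (Measure.count : Measure ℕ)) h.one_lt hmeas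
    simp only [lintegral_count] at hM
    have hlt := (hM.trans (tsum_bound_le fun k =>
      h.bound _ (n + 1) (by positivity) (div_two_pow_le one_pos hn k) 0 0)).trans_lt
      (ENNReal.mul_lt_top (ENNReal.mul_lt_top (geomConst_ne_top h.pos).lt_top
        (h.finite _ (by linarith)).lt_top) (by simp))
    rw [ENNReal.rpow_lt_top_iff_of_pos (by positivity)] at hlt
    filter_upwards [ae_lt_top ((Measurable.tsum hSm).pow_const r) hlt.ne] with x hx
    exact ((ENNReal.rpow_lt_top_iff_of_pos hr0).1 hx).ne
  have hU : (⋃ n : ℕ, Metric.ball (0 : Space d) (n + 1)) = Set.univ := by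
    refine Set.eq_univ_of_forall fun x => Set.mem_iUnion.2 ?_
    obtain ⟨n, hn⟩ := exists_nat_gt ‖x‖
    exact ⟨n, by rw [mem_ball_zero_iff]; linarith⟩
  rw [← Measure.restrict_univ (μ := (volume : Measure (Space d))), ← hU, ae_restrict_iUnion_iff]
  exact hball

/-- The limit of the time slices `E s (0, ·)` as `s ↓ 0`. -/
theorem exists_limit (h : IsScaleFamily r δ A S E) :
    ∃ g : Space d → ℝ, Measurable g ∧
      ∀ᵐ x, Tendsto (fun k : ℕ => E (1 / 2 ^ k) (0, x)) atTop (𝓝 (g x)) := by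
  have hsk : ∀ k : ℕ, (0 : ℝ) < 1 / 2 ^ k := fun k => by positivity
  refine measurable_limit_of_tendsto_metrizable_ae (fun k =>
    ((h.cont _ (hsk k)).comp (by fun_prop)).aemeasurable) ?_
  filter_upwards [h.ae_tsum_ne_top] with x hx
  refine cauchySeq_tendsto_of_complete (cauchySeq_of_edist_le_of_tsum_ne_top _ (fun k => ?_) hx)
  rw [edist_eq_enorm_sub, div_two_pow_succ]
  exact h.diff _ (hsk k) _

/-- Stated at the scales `2^(-n)` only, because `g` is defined as the limit along exactly these
scales. -/
theorem eLpNorm_limit_sub_le (h : IsScaleFamily r δ A S E) {g : Space d → ℝ}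
    (hg : ∀ᵐ x, Tendsto (fun k : ℕ => E (1 / 2 ^ k) (0, x)) atTop (𝓝 (g x))) {n : ℕ} {R : ℝ}
    (hR : 1 / 2 ^ n ≤ R) (x₀ : Space d) :
    eLpNorm (fun x => g x - E (1 / 2 ^ n) (0, x)) (ENNReal.ofReal r)
      (volume.restrict (Metric.ball x₀ R)) ≤
      geomConst δ * A R * ENNReal.ofReal (1 / 2 ^ n) ^ δ := by
  have hs : (0 : ℝ) < 1 / 2 ^ n := by positivity
  have hsk : ∀ k : ℕ, (0 : ℝ) < 1 / 2 ^ n / 2 ^ k := fun k => by positivity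
  have key := eLpNorm_sub_le_tsum (μ := volume.restrict (Metric.ball x₀ R)) h.one_lt
    (F := fun k x => E (1 / 2 ^ n / 2 ^ k) (0, x)) (f := g)
    (H := fun k x => S (1 / 2 ^ n / 2 ^ k) (0, x))
    (fun k => (h.meas _).comp (by fun_prop))
    (ae_restrict_of_ae (hg.mono fun x hx => by
      refine ((tendsto_add_atTop_iff_nat n).2 hx).congr fun k => ?_
      rw [pow_add, div_div, mul_comm])) (fun k x => by
        rw [div_two_pow_succ]; exact h.diff _ (hsk k) _)
  simp only [pow_zero, div_one] at key
  exact key.trans (tsum_bound_le fun k =>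
    h.bound _ R (hsk k) (div_two_pow_le hs hR k) 0 x₀)

theorem memLp_slice {W : SpaceTime d → ℝ} (hW : Continuous W) (x₀ : Space d) (R : ℝ)
    (p : ℝ≥0∞) :
    MemLp (fun x => W (0, x)) p (volume.restrict (Metric.ball x₀ R)) := by
  have hc : Continuous fun x : Space d => W (0, x) := hW.comp (by fun_prop)
  obtain ⟨C, hC⟩ := (isCompact_closedBall x₀ R).exists_bound_of_continuousOn hc.continuousOn
  have : IsFiniteMeasure (volume.restrict (Metric.ball x₀ R)) :=
    ⟨by simpa using measure_ball_lt_top⟩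
  refine MemLp.of_bound hc.aestronglyMeasurable C ?_
  filter_upwards [ae_restrict_mem measurableSet_ball] with x hx
  exact hC x (Metric.ball_subset_closedBall hx)

theorem memLp_limit (h : IsScaleFamily r δ A S E) {g : Space d → ℝ} (hgm : Measurable g)
    (hg : ∀ᵐ x, Tendsto (fun k : ℕ => E (1 / 2 ^ k) (0, x)) atTop (𝓝 (g x))) {R : ℝ} (hR : 0 < R)
    (x₀ : Space d) :
    MemLp g (ENNReal.ofReal r) (volume.restrict (Metric.ball x₀ R)) := by
  obtain ⟨n, hn⟩ := exists_pow_lt_of_lt_one hR (by norm_num : (1 / 2 : ℝ) < 1)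
  rw [one_div_pow] at hn
  have hc := h.cont (1 / 2 ^ n) (by positivity)
  have h1 : MemLp (fun x => g x - E (1 / 2 ^ n) (0, x)) (ENNReal.ofReal r)
      (volume.restrict (Metric.ball x₀ R)) := by
    refine ⟨(hgm.sub (hc.comp (by fun_prop)).measurable).aestronglyMeasurable,
      (h.eLpNorm_limit_sub_le hg hn.le x₀).trans_lt ?_⟩
    exact ENNReal.mul_lt_top (ENNReal.mul_lt_top (geomConst_ne_top h.pos).lt_top
      (h.finite _ hR).lt_top) (ENNReal.rpow_lt_top_of_nonneg h.pos.le ENNReal.ofReal_ne_top)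
  have h2 := h1.add (memLp_slice hc x₀ R (ENNReal.ofReal r))
  convert! h2 using 1
  funext x
  simp

/-- Compare `P ε` with `ζ_ε * E s`, then with `E s`, then with `g`. The outer errors are small with
`s`, uniformly in `ε`; the middle one tends to zero with `ε` at fixed `s`. The limit `g` does not
depend on `ζ`. -/
theorem tendsto_eLpNorm_sub (h : IsScaleFamily r δ A S E) {g : Space d → ℝ} (hgm : Measurable g)
    (hg : ∀ᵐ x, Tendsto (fun k : ℕ => E (1 / 2 ^ k) (0, x)) atTop (𝓝 (g x)))
    {ζ : SpaceTime d → ℝ} (hζ : IsMollifier ζ) {P : ℝ → SpaceTime d → ℝ}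
    (hPc : ∀ ε, 0 < ε → Continuous (P ε))
    (hP : ∀ ε s, 0 < ε → 0 < s → ∀ z,
      Tendsto (fun k : ℕ => mollify ζ ε (E (s / 2 ^ k)) z) atTop (𝓝 (P ε z)))
    {R : ℝ} (hR : 0 < R) (x₀ : Space d) :
    Tendsto (fun ε => eLpNorm (fun x => P ε (0, x) - g x) (ENNReal.ofReal r)
      (volume.restrict (Metric.ball x₀ R))) (𝓝[>] 0) (𝓝 0) := by
  set μ := volume.restrict (Metric.ball x₀ R)
  have hr1 : (1 : ℝ≥0∞) ≤ ENNReal.ofReal r := by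
    rw [← ENNReal.ofReal_one]; exact ENNReal.ofReal_le_ofReal h.one_lt.le
  rw [ENNReal.tendsto_nhds_zero]
  intro c hc
  have hc3 : 0 < c / 3 := ENNReal.div_pos hc.ne' (by simp)
  -- The scale is fixed before `ε`, which is possible because this tail bound does not involve `ε`.
  obtain ⟨n, hnR, hn⟩ : ∃ n : ℕ, (1 / 2 ^ n : ℝ) ≤ R ∧
      geomConst δ * A R * ENNReal.ofReal (1 / 2 ^ n) ^ δ ≤ c / 3 := by
    have ht := (tendsto_div_two_pow one_pos)
    have h1 : ∀ᶠ s in 𝓝[>] (0 : ℝ), s ≤ R := mem_nhdsWithin_of_mem_nhds (ge_mem_nhds hR)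
    have h2 : Tendsto (fun s : ℝ => geomConst δ * A R * ENNReal.ofReal s ^ δ) (𝓝[>] 0) (𝓝 0) := by
      have h3 : Tendsto (fun s : ℝ => ENNReal.ofReal s ^ δ) (𝓝[>] 0) (𝓝 0) := by
        have := ((ENNReal.continuous_rpow_const (y := δ)).comp
          ENNReal.continuous_ofReal).tendsto (0 : ℝ)
        simp only [Function.comp_def, ENNReal.ofReal_zero, ENNReal.zero_rpow_of_pos h.pos] at this
        exact this.mono_left nhdsWithin_le_nhds
      have := ENNReal.Tendsto.const_mul h3
        (Or.inr (ENNReal.mul_ne_top (geomConst_ne_top h.pos) (h.finite R hR)))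
      rwa [mul_zero] at this
    exact ((ht.eventually h1).and (ht.eventually (h2.eventually (ge_mem_nhds hc3)))).exists
  set s : ℝ := 1 / 2 ^ n with hs_def
  have hs : 0 < s := by positivity
  obtain ⟨C, hC0, hC⟩ : ∃ C : ℝ, 0 < C ∧ μ Set.univ ^ (1 / r) * ENNReal.ofReal C ≤ c / 3 := by
    have hμ : μ Set.univ ^ (1 / r) ≠ ⊤ := by
      refine (ENNReal.rpow_lt_top_of_nonneg (by have := h.one_lt; positivity) ?_).ne
      simpa [μ] using measure_ball_lt_top.ne
    have := ENNReal.Tendsto.const_mul (a := μ Set.univ ^ (1 / r))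
      (ENNReal.continuous_ofReal.tendsto 0 |>.mono_left (nhdsWithin_le_nhds (s := Set.Ioi 0)))
      (Or.inr hμ)
    rw [ENNReal.ofReal_zero, mul_zero] at this
    obtain ⟨C, h1, h2⟩ := ((this.eventually (ge_mem_nhds hc3)).and self_mem_nhdsWithin).exists
    exact ⟨C, h2, h1⟩
  have hK : IsCompact (({0} : Set ℝ) ×ˢ Metric.closedBall x₀ R) :=
    isCompact_singleton.prod (isCompact_closedBall _ _)
  filter_upwards [hζ.eventually_dist_mollify_le (h.cont s hs) hK hC0, self_mem_nhdsWithin]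
    with ε h1 hε
  have hε0 : 0 < ε := hε
  have hmc : Continuous (mollify ζ ε (E s)) := by
    have hm := hζ.parRescale hε0
    exact continuous_conv (h.cont s hs).locallyIntegrable hm.smooth.continuous hm.compact
  have hsl : ∀ {W : SpaceTime d → ℝ}, Continuous W →
      AEStronglyMeasurable (fun x : Space d => W (0, x)) μ := fun hW =>
    (hW.comp (by fun_prop)).aestronglyMeasurable
  have b1 := h.eLpNorm_sub_mollify_le hζ hε0 hs hnR (hP ε s hε0 hs) x₀
  have b2 : eLpNorm (fun x => mollify ζ ε (E s) (0, x) - E s (0, x)) (ENNReal.ofReal r) μ ≤ c / 3 := by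
    refine (eLpNorm_le_of_ae_bound (C := C) ?_).trans ?_
    · filter_upwards [ae_restrict_mem measurableSet_ball] with x hx
      exact h1 (0, x) ⟨rfl, Metric.ball_subset_closedBall hx⟩
    · rwa [ENNReal.toReal_ofReal (by linarith [h.one_lt]), ← one_div]
  have b3 := h.eLpNorm_limit_sub_le hg hnR x₀
  rw [← hs_def] at b3
  have e : (fun x => P ε (0, x) - g x) = fun x => (P ε (0, x) - mollify ζ ε (E s) (0, x)) +
      ((mollify ζ ε (E s) (0, x) - E s (0, x)) - (g x - E s (0, x))) := by
    funext x; ring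
  rw [e]
  calc _ ≤ eLpNorm (fun x => P ε (0, x) - mollify ζ ε (E s) (0, x)) (ENNReal.ofReal r) μ +
        (eLpNorm (fun x => mollify ζ ε (E s) (0, x) - E s (0, x)) (ENNReal.ofReal r) μ +
          eLpNorm (fun x => g x - E s (0, x)) (ENNReal.ofReal r) μ) := by
        exact eLpNorm_add_sub_le hr1 ((hsl (hPc ε hε0)).sub (hsl hmc))
          ((hsl hmc).sub (hsl (h.cont s hs))) (hgm.aestronglyMeasurable.sub (hsl (h.cont s hs)))
    _ ≤ c / 3 + (c / 3 + c / 3) := by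
        gcongr
        · exact b1.trans hn
        · exact b3.trans hn
    _ = c := by rw [← add_assoc]; exact ENNReal.add_thirds c

/-- The radius `R` need not be a power of two, whereas `g` is a limit along `2^(-k)`. The functions
`P ε` bridge this: they are the limit along `R / 2^k` of the `ζ_ε`-mollifications and also converge
to `g` as `ε ↓ 0`. -/
theorem eLpNorm_limit_le (h : IsScaleFamily r δ A S E) {g : Space d → ℝ} (hgm : Measurable g)
    (hg : ∀ᵐ x, Tendsto (fun k : ℕ => E (1 / 2 ^ k) (0, x)) atTop (𝓝 (g x)))
    {ζ : SpaceTime d → ℝ} (hζ : IsMollifier ζ) {P : ℝ → SpaceTime d → ℝ}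
    (hPc : ∀ ε, 0 < ε → Continuous (P ε))
    (hP : ∀ ε s, 0 < ε → 0 < s → ∀ z,
      Tendsto (fun k : ℕ => mollify ζ ε (E (s / 2 ^ k)) z) atTop (𝓝 (P ε z)))
    {R : ℝ} (hR : 0 < R) {M : ℝ≥0∞} (hM : ∀ z, ‖E R z‖ₑ ≤ M) (x₀ : Space d) :
    eLpNorm g (ENNReal.ofReal r) (volume.restrict (Metric.ball x₀ R)) ≤
      geomConst δ * A R * ENNReal.ofReal R ^ δ +
        volume (Metric.ball x₀ R) ^ (1 / r) * M := by
  set μ := volume.restrict (Metric.ball x₀ R) with hμ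
  have hr1 : (1 : ℝ≥0∞) ≤ ENNReal.ofReal r := by
    rw [← ENNReal.ofReal_one]; exact ENNReal.ofReal_le_ofReal h.one_lt.le
  have ht := h.tendsto_eLpNorm_sub hgm hg hζ hPc hP hR x₀
  have ht2 := ht.add_const (geomConst δ * A R * ENNReal.ofReal R ^ δ +
        volume (Metric.ball x₀ R) ^ (1 / r) * M)
  rw [zero_add] at ht2
  refine ge_of_tendsto ht2 ?_
  filter_upwards [self_mem_nhdsWithin] with ε hε
  have hε0 : 0 < ε := hε
  have hm := hζ.parRescale hε0
  have hmc : Continuous (mollify ζ ε (E R)) :=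
    continuous_conv (h.cont R hR).locallyIntegrable hm.smooth.continuous hm.compact
  have hsl : ∀ {W : SpaceTime d → ℝ}, Continuous W →
      AEStronglyMeasurable (fun x : Space d => W (0, x)) μ := fun hW =>
    (hW.comp (by fun_prop)).aestronglyMeasurable
  have b1 := h.eLpNorm_sub_mollify_le hζ hε0 hR le_rfl (hP ε R hε0 hR) x₀
  have b2 : eLpNorm (fun x => mollify ζ ε (E R) (0, x)) (ENNReal.ofReal r) μ ≤
      volume (Metric.ball x₀ R) ^ (1 / r) * M := by
    refine (eLpNorm_le_of_ae_enorm_bound (C := M) (Eventually.of_forall fun x => ?_)).trans_eq ?_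
    · refine (IsMollifier.enorm_mollify_le ζ hζ.nonneg hε0 _ _).trans ?_
      calc _ ≤ ∫⁻ w, M * ENNReal.ofReal (parRescale ζ ε w) := by
            gcongr; exact hM _
        _ = M := by
            rw [lintegral_const_mul _ hm.smooth.continuous.measurable.ennreal_ofReal,
              hm.lintegral_eq_one, mul_one]
    · rw [ENNReal.toReal_ofReal (by linarith [h.one_lt]), ← one_div, hμ]
      simp [mul_comm]
  have e : g = fun x => (P ε (0, x) - mollify ζ ε (E R) (0, x) + mollify ζ ε (E R) (0, x)) -
      (P ε (0, x) - g x) := by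
    funext x; ring
  calc eLpNorm g (ENNReal.ofReal r) μ
      ≤ eLpNorm (fun x => P ε (0, x) - mollify ζ ε (E R) (0, x) + mollify ζ ε (E R) (0, x))
          (ENNReal.ofReal r) μ + eLpNorm (fun x => P ε (0, x) - g x) (ENNReal.ofReal r) μ := by
        nth_rewrite 1 [e]
        exact eLpNorm_sub_le (((hsl (hPc ε hε0)).sub (hsl hmc)).add (hsl hmc))
          ((hsl (hPc ε hε0)).sub hgm.aestronglyMeasurable) hr1
    _ ≤ (eLpNorm (fun x => P ε (0, x) - mollify ζ ε (E R) (0, x)) (ENNReal.ofReal r) μ +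
          eLpNorm (fun x => mollify ζ ε (E R) (0, x)) (ENNReal.ofReal r) μ) +
        eLpNorm (fun x => P ε (0, x) - g x) (ENNReal.ofReal r) μ := by
        gcongr
        exact eLpNorm_add_le ((hsl (hPc ε hε0)).sub (hsl hmc)) (hsl hmc) hr1
    _ ≤ _ := by
        rw [add_comm]
        gcongr

end IsScaleFamily

end AbstractTrace

/-! ### Small and large scales combined for one scalar component. -/

section Component
variable {d : ℕ} {p q r β a : ℝ}

/-- The constant in the `L_r` bound of the dyadic differences. -/
noncomputable def sliceConst (d : ℕ) (p q r β : ℝ) : ℝ≥0∞ :=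
  ballVol d ^ (1 + 1 / r) * 2 ^ (d / p + 2 / q - β)

/-- The constant in the Morrey bound of one component of the trace. -/
noncomputable def traceConst (d : ℕ) (p q r β a : ℝ) (C : ℝ≥0) : ℝ≥0∞ :=
  geomConst (a - (d / p + 2 / q - d / r)) * (C * sliceConst d p q r β) * (ballVol d ^ (1 / r))⁻¹ +
    C * ballVol d * 2 ^ (a - β) * geomConst (β - a)

theorem sliceConst_ne_top (hr : 0 < r) : sliceConst d p q r β ≠ ⊤ :=
  ENNReal.mul_ne_top (ENNReal.rpow_ne_top_of_nonneg (by positivity) ballVol_ne_top)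
    (ENNReal.rpow_ne_top_of_ne_zero two_ne_zero ENNReal.ofNat_ne_top)

theorem traceConst_ne_top (hr : 0 < r) (hα : d / p + 2 / q - d / r < a) (hβ : a < β) (C : ℝ≥0) :
    traceConst d p q r β a C ≠ ⊤ := by
  refine ENNReal.add_ne_top.2 ⟨ENNReal.mul_ne_top (ENNReal.mul_ne_top
    (geomConst_ne_top (by linarith)) (ENNReal.mul_ne_top ENNReal.coe_ne_top (sliceConst_ne_top hr)))
    ?_, ENNReal.mul_ne_top (ENNReal.mul_ne_top (ENNReal.mul_ne_top ENNReal.coe_ne_top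
      ballVol_ne_top) ?_) (geomConst_ne_top (by linarith))⟩
  · rw [ENNReal.inv_ne_top]
    exact (ENNReal.rpow_pos (pos_iff_ne_zero.2 ballVol_ne_zero) ballVol_ne_top).ne'
  · exact ENNReal.rpow_ne_top_of_ne_zero two_ne_zero ENNReal.ofNat_ne_top

variable {F G : Type*} [NormedAddCommGroup F] [NormedAddCommGroup G] {f : SpaceTime d → F}
  {g : SpaceTime d → G}

theorem isScaleFamily_of_sub_le (hp : 1 < p) (hq : 1 < q) (hr : p ≤ r)
    (hα : d / p + 2 / q - d / r < a) (hf : MemParMorrey p q β f) (hg : MemParMorrey p q β g)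
    {C : ℝ≥0} {E : ℝ → SpaceTime d → ℝ} (hE : ∀ s, 0 < s → Continuous (E s))
    (hd : ∀ s, 0 < s → ∀ z, ‖E s z - E (s / 2) z‖ₑ ≤ C * ENNReal.ofReal s ^ a *
      (cylMean s (fun w => ‖f w‖ₑ) z + cylMean s (fun w => ‖g w‖ₑ) z)) :
    IsScaleFamily r (a - (d / p + 2 / q - d / r))
      (fun R => C * sliceConst d p q r β * ENNReal.ofReal R ^ (d / p + 2 / q - β) *
        (parMorreyNorm p q β f + parMorreyNorm p q β g))
      (fun s z => C * ENNReal.ofReal s ^ a *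
        (cylMean s (fun w => ‖f w‖ₑ) z + cylMean s (fun w => ‖g w‖ₑ) z)) E where
  one_lt := by linarith
  pos := by linarith
  finite R hR := ENNReal.mul_ne_top (ENNReal.mul_ne_top (ENNReal.mul_ne_top ENNReal.coe_ne_top
    (sliceConst_ne_top (by linarith))) (ENNReal.rpow_ne_top_of_ne_zero (by simpa using hR)
      ENNReal.ofReal_ne_top)) (ENNReal.add_ne_top.2 ⟨hf.2.ne, hg.2.ne⟩)
  meas s := ((measurable_cylMean hf.1.enorm s).add (measurable_cylMean hg.1.enorm s)).const_mul _
  cont := hE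
  diff := hd
  bound s R hs hsR t x₀ := by
    have hr0 : 0 < r := by linarith
    have h0 : ENNReal.ofReal s ≠ 0 := by simpa using hs
    have hmf : Measurable fun x : Space d => cylMean s (fun w => ‖f w‖ₑ) (t, x) :=
      (measurable_cylMean hf.1.enorm s).comp (by fun_prop)
    have hmg : Measurable fun x : Space d => cylMean s (fun w => ‖g w‖ₑ) (t, x) :=
      (measurable_cylMean hg.1.enorm s).comp (by fun_prop)
    have hmfg : Measurable fun x : Space d => (cylMean s (fun w => ‖f w‖ₑ) (t, x) +
        cylMean s (fun w => ‖g w‖ₑ) (t, x)) ^ r := (hmf.add hmg).pow_const r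
    simp only [ENNReal.mul_rpow_of_nonneg _ _ hr0.le]
    rw [lintegral_const_mul _ hmfg, ← ENNReal.mul_rpow_of_nonneg _ _ hr0.le,
      ENNReal.mul_rpow_of_nonneg _ _ (by positivity : 0 ≤ 1 / r), ← ENNReal.rpow_mul,
      mul_one_div_cancel hr0.ne', ENNReal.rpow_one]
    have hadd := ENNReal.lintegral_Lp_add_le (μ := volume.restrict (Metric.ball x₀ R))
      hmf.aemeasurable hmg.aemeasurable (by linarith : 1 ≤ r)
    calc _ ≤ C * ENNReal.ofReal s ^ a *
          (sliceConst d p q r β * ENNReal.ofReal s ^ (-(d / p + 2 / q - d / r)) *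
            ENNReal.ofReal R ^ (d / p + 2 / q - β) * parMorreyNorm p q β f +
          sliceConst d p q r β * ENNReal.ofReal s ^ (-(d / p + 2 / q - d / r)) *
            ENNReal.ofReal R ^ (d / p + 2 / q - β) * parMorreyNorm p q β g) := by
          refine mul_le_mul_right (hadd.trans (add_le_add ?_ ?_)) _
          · exact lintegral_cylMean_le hp hq hr β hf.1 hs hsR t x₀
          · exact lintegral_cylMean_le hp hq hr β hg.1 hs hsR t x₀
      _ = _ := by
          rw [sub_eq_add_neg a, ENNReal.rpow_add _ _ h0 ENNReal.ofReal_ne_top]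
          ring

/-- Telescoping upwards from `R` to infinity, where `E` vanishes, with the pointwise bound `s^(a-β)`
at each scale. The first scale is `2R`, which accounts for the factor `2^(a-β)`; for `a < β` the
series converges. -/
theorem enorm_le_of_sub_le (hp : 1 < p) (hq : 1 < q) (hf : MemParMorrey p q β f)
    (hg : MemParMorrey p q β g) {C : ℝ≥0} {E : ℝ → SpaceTime d → ℝ}
    (hd : ∀ s, 0 < s → ∀ z, ‖E s z - E (s / 2) z‖ₑ ≤ C * ENNReal.ofReal s ^ a *
      (cylMean s (fun w => ‖f w‖ₑ) z + cylMean s (fun w => ‖g w‖ₑ) z))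
    (h0 : ∀ z, Tendsto (fun s => E s z) atTop (𝓝 0)) {R : ℝ} (hR : 0 < R) (z : SpaceTime d) :
    ‖E R z‖ₑ ≤ C * ballVol d * 2 ^ (a - β) * geomConst (β - a) * ENNReal.ofReal R ^ (a - β) *
      (parMorreyNorm p q β f + parMorreyNorm p q β g) := by
  have hR0 : ENNReal.ofReal R ≠ 0 := by simpa using hR
  set N := parMorreyNorm p q β f + parMorreyNorm p q β g with hN
  have hstep : ∀ s, 0 < s → ‖E s z - E (s / 2) z‖ₑ ≤
      C * ballVol d * N * ENNReal.ofReal s ^ (a - β) := fun s hs => by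
    have hs0 : ENNReal.ofReal s ≠ 0 := by simpa using hs
    refine (hd s hs z).trans ?_
    calc _ ≤ C * ENNReal.ofReal s ^ a *
          (ballVol d * ENNReal.ofReal s ^ (-β) * parMorreyNorm p q β f +
            ballVol d * ENNReal.ofReal s ^ (-β) * parMorreyNorm p q β g) := by
          gcongr
          · exact cylMean_le hp hq hf.1 β hs z
          · exact cylMean_le hp hq hg.1 β hs z
      _ = _ := by
          rw [sub_eq_add_neg a, ENNReal.rpow_add _ _ hs0 ENNReal.ofReal_ne_top, hN]
          ring
  have ht : Tendsto (fun k : ℕ => E (R * 2 ^ k) z) atTop (𝓝 0) :=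
    (h0 z).comp ((tendsto_pow_atTop_atTop_of_one_lt one_lt_two).const_mul_atTop hR)
  have hpow : ∀ k : ℕ, ENNReal.ofReal (R * 2 ^ (k + 1)) ^ (a - β) =
      2 ^ (a - β) * ENNReal.ofReal R ^ (a - β) * (2 ^ (-(β - a))) ^ k := fun k => by
    rw [ENNReal.ofReal_mul hR.le, ENNReal.ofReal_pow (by norm_num),
      ENNReal.mul_rpow_of_ne_top ENNReal.ofReal_ne_top (by simp), pow_succ,
      ENNReal.mul_rpow_of_ne_top (by simp) (by simp), neg_sub, ← ENNReal.rpow_natCast,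
      ← ENNReal.rpow_natCast, ← ENNReal.rpow_mul, ← ENNReal.rpow_mul, ENNReal.ofReal_ofNat,
      mul_comm (k : ℝ)]
    ring
  have := edist_le_tsum_of_edist_le_of_tendsto₀
    (fun k => C * ballVol d * N * ENNReal.ofReal (R * 2 ^ (k + 1)) ^ (a - β)) (fun k => by
      rw [edist_comm, edist_eq_enorm_sub]
      have := hstep (R * 2 ^ (k + 1)) (by positivity)
      rwa [show R * 2 ^ (k + 1) / 2 = R * 2 ^ k by rw [pow_succ]; ring] at this) ht
  simp only [hpow, pow_zero, mul_one, edist_zero_right] at this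
  rw [ENNReal.tsum_mul_left, ENNReal.tsum_mul_left, ENNReal.tsum_geometric] at this
  refine this.trans_eq ?_
  rw [geomConst]
  ring

/-- Used with `a = 2` for `u` and with `a = 1` for each `D_j u`. Decay at infinity is assumed only
for the norm bound, so that existence of the trace is available without `a < β`. -/
theorem exists_trace_component (hp : 1 < p) (hq : 1 < q) (hr : p ≤ r)
    (hα : d / p + 2 / q - d / r < a) (hf : MemParMorrey p q β f) (hg : MemParMorrey p q β g)
    {C : ℝ≥0} {E : ℝ → SpaceTime d → ℝ} (hE : ∀ s, 0 < s → Continuous (E s))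
    (hd : ∀ s, 0 < s → ∀ z, ‖E s z - E (s / 2) z‖ₑ ≤ C * ENNReal.ofReal s ^ a *
      (cylMean s (fun w => ‖f w‖ₑ) z + cylMean s (fun w => ‖g w‖ₑ) z))
    {P : (SpaceTime d → ℝ) → ℝ → SpaceTime d → ℝ}
    (hPc : ∀ ζ, IsMollifier ζ → ∀ ε, 0 < ε → Continuous (P ζ ε))
    (hP : ∀ ζ, IsMollifier ζ → ∀ ε s, 0 < ε → 0 < s → ∀ z,
      Tendsto (fun k : ℕ => mollify ζ ε (E (s / 2 ^ k)) z) atTop (𝓝 (P ζ ε z)))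
    {ζ₀ : SpaceTime d → ℝ} (hζ₀ : IsMollifier ζ₀) :
    ∃ h : Space d → ℝ, Measurable h ∧ (∀ x₀ R, 0 < R →
      MemLp h (ENNReal.ofReal r) (volume.restrict (Metric.ball x₀ R)) ∧
      ∀ ζ, IsMollifier ζ → Tendsto (fun ε => eLpNorm (fun x => P ζ ε (0, x) - h x)
        (ENNReal.ofReal r) (volume.restrict (Metric.ball x₀ R))) (𝓝[>] 0) (𝓝 0)) ∧
      ((∀ z, Tendsto (fun s => E s z) atTop (𝓝 0)) → ∀ x₀ R, 0 < R →
        ENNReal.ofReal R ^ (β - a) * ((volume (Metric.ball x₀ R) ^ (1 / r))⁻¹ *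
          eLpNorm h (ENNReal.ofReal r) (volume.restrict (Metric.ball x₀ R))) ≤
        traceConst d p q r β a C * (parMorreyNorm p q β f + parMorreyNorm p q β g)) := by
  have hfam := isScaleFamily_of_sub_le hp hq hr hα hf hg hE hd
  obtain ⟨h, hm, hlim⟩ := hfam.exists_limit
  refine ⟨h, hm, fun x₀ R hR => ⟨hfam.memLp_limit hm hlim hR x₀, fun ζ hζ =>
    hfam.tendsto_eLpNorm_sub hm hlim hζ (hPc ζ hζ) (hP ζ hζ) hR x₀⟩, fun h0 x₀ R hR => ?_⟩
  have hr0 : 0 < r := by linarith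
  have hR0 : ENNReal.ofReal R ≠ 0 := by simpa using hR
  have hRt : ENNReal.ofReal R ≠ ⊤ := ENNReal.ofReal_ne_top
  have hM := hfam.eLpNorm_limit_le hm hlim hζ₀ (hPc ζ₀ hζ₀) (hP ζ₀ hζ₀) hR
    (enorm_le_of_sub_le hp hq hf hg hd h0 hR) x₀
  set N := parMorreyNorm p q β f + parMorreyNorm p q β g
  set V := volume (Metric.ball x₀ R) ^ (1 / r) with hV
  have hVeq : V = ENNReal.ofReal R ^ (d / r) * ballVol d ^ (1 / r) := by
    rw [hV, volume_ball_eq _ hR, ENNReal.mul_rpow_of_nonneg _ _ (by positivity),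
      ← ENNReal.rpow_mul, mul_one_div]
  have hb0 : ballVol d ^ (1 / r) ≠ 0 :=
    (ENNReal.rpow_pos (pos_iff_ne_zero.2 ballVol_ne_zero) ballVol_ne_top).ne'
  have hRd0 : ENNReal.ofReal R ^ (d / r) ≠ 0 := (ENNReal.rpow_pos (pos_iff_ne_zero.2 hR0) hRt).ne'
  have hRdt : ENNReal.ofReal R ^ (d / r) ≠ ⊤ := ENNReal.rpow_ne_top_of_ne_zero hR0 hRt
  have hVinv : V⁻¹ = ENNReal.ofReal R ^ (-(d / r)) * (ballVol d ^ (1 / r))⁻¹ := by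
    rw [hVeq, ENNReal.mul_inv (Or.inl hRd0) (Or.inl hRdt), ENNReal.rpow_neg]
  have hV0 : V ≠ 0 := by rw [hVeq]; exact mul_ne_zero hRd0 hb0
  have hVt : V ≠ ⊤ := by
    rw [hVeq]
    exact ENNReal.mul_ne_top hRdt (ENNReal.rpow_ne_top_of_nonneg (by positivity) ballVol_ne_top)
  have hVV : V⁻¹ * V = 1 := ENNReal.inv_mul_cancel hV0 hVt
  -- Scale invariance: all powers of `R` cancel in the small-scale term, and `e2` does the same for
  -- the large-scale term.
  have e1 : ENNReal.ofReal R ^ (β - a) * (ENNReal.ofReal R ^ (-(d / r)) *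
      (ENNReal.ofReal R ^ (d / p + 2 / q - β) *
        ENNReal.ofReal R ^ (a - (d / p + 2 / q - d / r)))) = 1 := by
    rw [← ENNReal.rpow_add _ _ hR0 hRt, ← ENNReal.rpow_add _ _ hR0 hRt,
      ← ENNReal.rpow_add _ _ hR0 hRt]
    convert! ENNReal.rpow_zero
    ring
  have e2 : ENNReal.ofReal R ^ (β - a) * ENNReal.ofReal R ^ (a - β) = 1 := by
    rw [← ENNReal.rpow_add _ _ hR0 hRt]
    convert! ENNReal.rpow_zero
    ring
  set Rba := ENNReal.ofReal R ^ (β - a)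
  refine (mul_le_mul_right (mul_le_mul_right hM _) _).trans_eq ?_
  set T := C * ballVol d * 2 ^ (a - β) * geomConst (β - a)
  calc _ = geomConst (a - (d / p + 2 / q - d / r)) * (C * sliceConst d p q r β) *
        (ballVol d ^ (1 / r))⁻¹ * N * (Rba * (ENNReal.ofReal R ^ (-(d / r)) *
        (ENNReal.ofReal R ^ (d / p + 2 / q - β) *
          ENNReal.ofReal R ^ (a - (d / p + 2 / q - d / r))))) +
        T * N * (Rba * ENNReal.ofReal R ^ (a - β)) * (V⁻¹ * V) := by
        rw [mul_add, mul_add]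
        congr 1
        · rw [hVinv]; ring
        · ring
    _ = _ := by
        rw [e1, e2, hVV, traceConst]
        ring

end Component

/-! ### Uniqueness of traces and assembly of the components. -/

section Assembly
variable {d : ℕ} {p q r β : ℝ}

/-- Limits in `L_r` are unique on each ball, and countably many balls exhaust the space. -/
theorem ae_eq_of_isTraceAlong {ζ : SpaceTime d → ℝ} (hζ : IsMollifier ζ) {γ : ℕ} (hr : 1 ≤ r)
    {u : SpaceTime d → ℝ} (hu : LocallyIntegrable u volume)
    {g g' : Space d → (Space d [×γ]→L[ℝ] ℝ)} (hg : IsTraceAlong ζ γ r u g)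
    (hg' : IsTraceAlong ζ γ r u g') : g' =ᵐ[volume] g := by
  have hr1 : (1 : ℝ≥0∞) ≤ ENNReal.ofReal r := by
    rw [← ENNReal.ofReal_one]; exact ENNReal.ofReal_le_ofReal hr
  have hball : ∀ n : ℕ, g' =ᵐ[volume.restrict (Metric.ball (0 : Space d) (n + 1))] g := fun n => by
    set μ := volume.restrict (Metric.ball (0 : Space d) (n + 1))
    obtain ⟨hm, ht⟩ := hg 0 (n + 1) (by positivity)
    obtain ⟨hm', ht'⟩ := hg' 0 (n + 1) (by positivity)
    have hsum := ht.add ht'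
    rw [add_zero] at hsum
    have hle : eLpNorm (fun x => g' x - g x) (ENNReal.ofReal r) μ ≤ 0 := by
      refine ge_of_tendsto hsum ?_
      filter_upwards [self_mem_nhdsWithin] with ε hε
      have hz := hζ.parRescale hε
      have hcont : AEStronglyMeasurable
          (fun x => iteratedFDeriv ℝ γ (fun y : Space d => mollify ζ ε u (0, y)) x) μ := by
        refine Continuous.aestronglyMeasurable ?_
        refine ContDiff.continuous_iteratedFDeriv (n := ∞) (by exact_mod_cast le_top) ?_
        exact (contDiff_conv hu hz.smooth hz.compact).comp (contDiff_const.prodMk contDiff_id)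
      have e : (fun x => g' x - g x) = fun x =>
          (iteratedFDeriv ℝ γ (fun y : Space d => mollify ζ ε u (0, y)) x - g x) -
          (iteratedFDeriv ℝ γ (fun y : Space d => mollify ζ ε u (0, y)) x - g' x) := by
        funext x; abel
      rw [e]
      exact eLpNorm_sub_le (hcont.sub hm.1) (hcont.sub hm'.1) hr1
    have h0 := (eLpNorm_eq_zero_iff (hm'.1.sub hm.1) (by positivity)).1 (le_antisymm hle bot_le)
    filter_upwards [h0] with x hx
    exact sub_eq_zero.1 hx
  have hU : (⋃ n : ℕ, Metric.ball (0 : Space d) (n + 1)) = Set.univ := by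
    refine Set.eq_univ_of_forall fun x => Set.mem_iUnion.2 ?_
    obtain ⟨n, hn⟩ := exists_nat_gt ‖x‖
    exact ⟨n, by rw [mem_ball_zero_iff]; linarith⟩
  rw [← Measure.restrict_univ (μ := (volume : Measure (Space d))), ← hU]
  exact (ae_restrict_iUnion_iff _ _).2 hball

theorem eLpNorm_sum_smul_le {ι X Y : Type*} [Fintype ι] [NormedAddCommGroup X] [NormedSpace ℝ X]
    [MeasurableSpace Y] {μ : Measure Y} {p : ℝ≥0∞} (hp : 1 ≤ p) {b : ι → X} (hb : ∀ i, ‖b i‖ ≤ 1)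
    {f : ι → Y → ℝ} (hf : ∀ i, AEStronglyMeasurable (f i) μ) :
    eLpNorm (fun x => ∑ i, f i x • b i) p μ ≤ ∑ i, eLpNorm (f i) p μ := by
  have e : (fun x => ∑ i, f i x • b i) = ∑ i, fun x => f i x • b i := by
    funext x; simp
  rw [e]
  refine (eLpNorm_sum_le (fun i _ => (hf i).smul_const (b i)) hp).trans
    (Finset.sum_le_sum fun i _ => eLpNorm_mono fun x => ?_)
  rw [norm_smul]
  exact mul_le_of_le_one_right (norm_nonneg _) (hb i)

theorem memLp_sum_smul {ι X Y : Type*} [Fintype ι] [NormedAddCommGroup X] [NormedSpace ℝ X]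
    [MeasurableSpace Y] {μ : Measure Y} {p : ℝ≥0∞} (hp : 1 ≤ p) {b : ι → X} (hb : ∀ i, ‖b i‖ ≤ 1)
    {f : ι → Y → ℝ} (hf : ∀ i, MemLp (f i) p μ) : MemLp (fun x => ∑ i, f i x • b i) p μ :=
  ⟨Finset.aestronglyMeasurable_fun_sum _ fun i _ => (hf i).1.smul_const (b i),
    (eLpNorm_sum_smul_le hp hb fun i => (hf i).1).trans_lt
      (ENNReal.sum_lt_top.2 fun i _ => (hf i).2)⟩

/-- A trace assembled from finitely many scalar components. -/
theorem isUniqueTrace_sum {ι : Type*} [Fintype ι] {γ : ℕ} (hr : 1 ≤ r) {u : SpaceTime d → ℝ}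
    (hu : LocallyIntegrable u volume) {b : ι → (Space d [×γ]→L[ℝ] ℝ)} (hb : ∀ i, ‖b i‖ ≤ 1)
    {P : ι → (SpaceTime d → ℝ) → ℝ → SpaceTime d → ℝ}
    (hPc : ∀ i ζ, IsMollifier ζ → ∀ ε, 0 < ε → Continuous (P i ζ ε))
    (hP : ∀ ζ, IsMollifier ζ → ∀ ε, 0 < ε → ∀ x,
      iteratedFDeriv ℝ γ (fun y : Space d => mollify ζ ε u (0, y)) x = ∑ i, P i ζ ε (0, x) • b i)
    {h : ι → Space d → ℝ} (hh : ∀ i x₀ R, 0 < R →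
      MemLp (h i) (ENNReal.ofReal r) (volume.restrict (Metric.ball x₀ R)) ∧
      ∀ ζ, IsMollifier ζ → Tendsto (fun ε => eLpNorm (fun x => P i ζ ε (0, x) - h i x)
        (ENNReal.ofReal r) (volume.restrict (Metric.ball x₀ R))) (𝓝[>] 0) (𝓝 0)) :
    IsUniqueTrace γ r u (fun x => ∑ i, h i x • b i) ∧
      ∀ x₀ R, 0 < R → eLpNorm (fun x => ∑ i, h i x • b i) (ENNReal.ofReal r)
        (volume.restrict (Metric.ball x₀ R)) ≤
        ∑ i, eLpNorm (h i) (ENNReal.ofReal r) (volume.restrict (Metric.ball x₀ R)) := by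
  have hr1 : (1 : ℝ≥0∞) ≤ ENNReal.ofReal r := by
    rw [← ENNReal.ofReal_one]; exact ENNReal.ofReal_le_ofReal hr
  have htr : ∀ ζ, IsMollifier ζ → IsTraceAlong ζ γ r u (fun x => ∑ i, h i x • b i) := by
    intro ζ hζ x₀ R hR
    refine ⟨memLp_sum_smul hr1 hb fun i => (hh i x₀ R hR).1, ?_⟩
    have hlim : Tendsto (fun ε => ∑ i, eLpNorm (fun x => P i ζ ε (0, x) - h i x)
        (ENNReal.ofReal r) (volume.restrict (Metric.ball x₀ R))) (𝓝[>] 0)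
        (𝓝 (∑ _i : ι, 0)) :=
      tendsto_finsetSum _ fun i _ => (hh i x₀ R hR).2 ζ hζ
    rw [Finset.sum_const_zero] at hlim
    refine tendsto_of_tendsto_of_tendsto_of_le_of_le' tendsto_const_nhds hlim
      (Eventually.of_forall fun _ => bot_le) ?_
    filter_upwards [self_mem_nhdsWithin] with ε hε
    have e : (fun x => iteratedFDeriv ℝ γ (fun y : Space d => mollify ζ ε u (0, y)) x -
        ∑ i, h i x • b i) = fun x => ∑ i, (P i ζ ε (0, x) - h i x) • b i := by
      funext x
      rw [hP ζ hζ ε hε, ← Finset.sum_sub_distrib]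
      exact Finset.sum_congr rfl fun i _ => (sub_smul _ _ _).symm
    rw [e]
    exact eLpNorm_sum_smul_le hr1 hb fun i => (((hPc i ζ hζ ε hε).comp (by fun_prop)).aestronglyMeasurable).sub
      (hh i x₀ R hR).1.1
  exact ⟨⟨htr, fun ζ hζ g' hg' => ae_eq_of_isTraceAlong hζ hr hu (htr ζ hζ) hg'⟩,
    fun x₀ R hR => eLpNorm_sum_smul_le hr1 hb fun i => (hh i x₀ R hR).1.1⟩

theorem morreyNorm_sum_le {ι : Type*} [Fintype ι] {X : Type*} [NormedAddCommGroup X] {s : ℝ}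
    {G : Space d → X} {h : ι → Space d → ℝ} {K : ι → ℝ≥0∞}
    (hG : ∀ x₀ R, 0 < R → eLpNorm G (ENNReal.ofReal r) (volume.restrict (Metric.ball x₀ R)) ≤
        ∑ i, eLpNorm (h i) (ENNReal.ofReal r) (volume.restrict (Metric.ball x₀ R)))
    (hK : ∀ i x₀ R, 0 < R → ENNReal.ofReal R ^ s * ((volume (Metric.ball x₀ R) ^ (1 / r))⁻¹ *
      eLpNorm (h i) (ENNReal.ofReal r) (volume.restrict (Metric.ball x₀ R))) ≤ K i) :
    morreyNorm r s G ≤ ∑ i, K i := by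
  refine iSup_le fun R => iSup_le fun hR => iSup_le fun x₀ => ?_
  refine (mul_le_mul_right (mul_le_mul_right (hG x₀ R hR) _) _).trans ?_
  rw [Finset.mul_sum, Finset.mul_sum]
  exact Finset.sum_le_sum fun i _ => hK i x₀ R hR

variable {u ut : SpaceTime d → ℝ} {Du : SpaceTime d → EuclideanSpace ℝ (Fin d)}
  {D2u : SpaceTime d → EuclideanSpace ℝ (Fin d × Fin d)} {η θ ψ : SpaceTime d → ℝ}

theorem tendsto_ofReal_rpow_atTop {b : ℝ} (hb : 0 < b) :
    Tendsto (fun s : ℝ => ENNReal.ofReal s ^ (-b)) atTop (𝓝 0) := by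
  have h := (ENNReal.tendsto_ofReal_atTop.ennrpow_const b)
  rw [ENNReal.top_rpow_of_pos hb] at h
  have h2 := tendsto_inv_iff.2 h
  simpa only [ENNReal.inv_top, ENNReal.rpow_neg] using h2

/-- Here the membership of `u` itself in the Morrey space enters, and only qualitatively: for `β >
0` its means over large cylinders tend to zero. This excludes, for instance, nonzero constants. -/
theorem tendsto_conv_parRescale_atTop {κ : SpaceTime d → ℝ} (hp : 1 < p) (hq : 1 < q)
    (hβ : 0 < β) (hκ : IsUnitKernel κ) (hu : MemParMorrey p q β u) (z : SpaceTime d) :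
    Tendsto (fun s => conv u (parRescale κ s) z) atTop (𝓝 0) := by
  obtain ⟨C, hC⟩ := hκ.exists_bound
  rw [tendsto_zero_iff_enorm_tendsto_zero]
  have hlim : Tendsto (fun s : ℝ => C * (ballVol d * ENNReal.ofReal s ^ (-β) *
      parMorreyNorm p q β u)) atTop (𝓝 0) := by
    have h1 := ENNReal.Tendsto.const_mul (a := ballVol d) (tendsto_ofReal_rpow_atTop hβ)
      (Or.inr ballVol_ne_top)
    have h2 := ENNReal.Tendsto.const_mul (a := C) (ENNReal.Tendsto.mul_const h1 (Or.inr hu.2.ne))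
      (Or.inr ENNReal.coe_ne_top)
    simpa using h2
  refine tendsto_of_tendsto_of_tendsto_of_le_of_le' tendsto_const_nhds hlim
    (Eventually.of_forall fun _ => bot_le) ?_
  filter_upwards [eventually_gt_atTop 0] with s hs
  refine (enorm_conv_parRescale_le hκ hC hs u z).trans ?_
  gcongr
  exact cylMean_le hp hq hu.1 β hs z

/-- The condition `2 < β` guards only the estimate, since the case `γ = 1` needs the trace of `u`
even when `β ≤ 2`. -/
theorem exists_trace_zero (hp : 1 < p) (hq : 1 < q) (hr : p ≤ r) (hd : 0 < d) :
    ∃ N : ℝ≥0, d / p + 2 / q < 2 + d / r →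
      ∀ (u ut : SpaceTime d → ℝ) (Du : SpaceTime d → EuclideanSpace ℝ (Fin d))
        (D2u : SpaceTime d → EuclideanSpace ℝ (Fin d × Fin d)),
        MemParMorreySobolev p q β u ut Du D2u →
        ∃ v : Space d → (Space d [×0]→L[ℝ] ℝ), IsUniqueTrace 0 r u v ∧
          (2 < β → morreyNorm r (β - 2) v ≤
            N * (parMorreyNorm p q β ut + parMorreyNorm p q β D2u)) := by
  obtain ⟨η, θ, ψ, hK⟩ := exists_isHeatKernel hd
  obtain ⟨C, hC⟩ := exists_mollify_sub_le hK
  refine ⟨(traceConst d p q r β 2 C).toNNReal, fun hα u ut Du D2u hu => ?_⟩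
  have hul := hu.weak_time.1
  have hcont : ∀ ζ, IsMollifier ζ → ∀ ε, 0 < ε → Continuous (mollify ζ ε u) := fun ζ hζ ε hε =>
    continuous_conv hul (hζ.parRescale hε).smooth.continuous (hζ.parRescale hε).compact
  obtain ⟨h, -, hh, hbd⟩ := exists_trace_component (a := 2) hp hq hr (by linarith) hu.mem_time
    hu.mem_space_space (C := C) (E := fun s => mollify η s u) (P := fun ζ ε => mollify ζ ε u)
    (hcont η hK.mollifier) (hC u ut Du D2u hu.weak_time hu.weak_space hu.weak_space_space)
    hcont (fun ζ hζ ε s hε hs z => by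
      have hs' : ∀ k : ℕ, 0 < s / 2 ^ k := fun k => by positivity
      simp only [fun k => mollify_mollify hζ hK.mollifier hul hε (hs' k)]
      exact (hK.mollifier.tendsto_mollify (hcont ζ hζ ε hε) z).comp (tendsto_div_two_pow hs))
    hK.mollifier
  obtain ⟨h1, h2⟩ := isUniqueTrace_sum (ι := Unit) (γ := 0) (r := r) (by linarith) hul
    (b := fun _ => ContinuousMultilinearMap.constOfIsEmpty ℝ (fun _ : Fin 0 => Space d) (1 : ℝ))
    (fun _ => by simp) (P := fun _ ζ ε => mollify ζ ε u) (fun _ => hcont)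
    (fun ζ _ ε _ x => by
      ext m
      simp [iteratedFDeriv_zero_apply]) (h := fun _ => h) (fun _ => hh)
  refine ⟨_, h1, fun hβ => ?_⟩
  have h3 := morreyNorm_sum_le h2 (fun _ => hbd fun z =>
    tendsto_conv_parRescale_atTop hp hq (by linarith) hK.kernel hu.mem z)
  rw [ENNReal.coe_toNNReal (traceConst_ne_top (by linarith) (by linarith) hβ C)]
  simpa using h3

/-- The gradient is the sum of its components times the coordinate functionals, which have norm at
most one, so the constants of the components add up. -/
theorem exists_trace_one (hp : 1 < p) (hq : 1 < q) (hr : p ≤ r) (hd : 0 < d) :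
    ∃ N : ℝ≥0, d / p + 2 / q < 1 + d / r → 1 < β →
      ∀ (u ut : SpaceTime d → ℝ) (Du : SpaceTime d → EuclideanSpace ℝ (Fin d))
        (D2u : SpaceTime d → EuclideanSpace ℝ (Fin d × Fin d)),
        MemParMorreySobolev p q β u ut Du D2u →
        ∃ v : Space d → (Space d [×1]→L[ℝ] ℝ), IsUniqueTrace 1 r u v ∧
          morreyNorm r (β - 1) v ≤
            N * (parMorreyNorm p q β ut + parMorreyNorm p q β D2u) := by
  obtain ⟨η, θ, ψ, hK⟩ := exists_isHeatKernel hd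
  choose C hC using fun j : Fin d => exists_dirDeriv_mollify_sub_le hK j
  refine ⟨∑ j, (traceConst d p q r β 1 (C j)).toNNReal, fun hα hβ u ut Du D2u hu => ?_⟩
  have hul := hu.weak_time.1
  have hsm : ∀ ζ, IsMollifier ζ → ∀ ε, 0 < ε → ContDiff ℝ ∞ (mollify ζ ε u) := fun ζ hζ ε hε =>
    contDiff_conv hul (hζ.parRescale hε).smooth (hζ.parRescale hε).compact
  have hcont : ∀ (j : Fin d) ζ, IsMollifier ζ → ∀ ε, 0 < ε →
      Continuous (dirDeriv (spaceDir j) (mollify ζ ε u)) := fun j ζ hζ ε hε =>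
    (contDiff_dirDeriv (hsm ζ hζ ε hε) _).continuous
  have hcomp := fun j => exists_trace_component (a := 1) hp hq hr (by linarith) hu.mem_time
    hu.mem_space_space (C := C j) (E := fun s => dirDeriv (spaceDir j) (mollify η s u))
    (P := fun ζ ε => dirDeriv (spaceDir j) (mollify ζ ε u))
    (hcont j η hK.mollifier) (hC j u ut Du D2u hu.weak_time hu.weak_space hu.weak_space_space)
    (hcont j) (fun ζ hζ ε s hε hs z => by
      have hs' : ∀ k : ℕ, 0 < s / 2 ^ k := fun k => by positivity
      simp only [fun k => mollify_dirDeriv_mollify hζ hK.mollifier hul hε (hs' k)]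
      exact (hK.mollifier.tendsto_mollify (hcont j ζ hζ ε hε) z).comp (tendsto_div_two_pow hs))
    hK.mollifier
  choose h _ hh hbd using hcomp
  obtain ⟨h1, h2⟩ := isUniqueTrace_sum (ι := Fin d) (γ := 1) (r := r) (by linarith) hul
    (b := fun j => (continuousMultilinearCurryFin1 ℝ (Space d) ℝ).symm
      (EuclideanSpace.proj (𝕜 := ℝ) j)) (fun j => by
        rw [LinearIsometryEquiv.norm_map]
        refine ContinuousLinearMap.opNorm_le_bound _ zero_le_one fun x => ?_
        rw [one_mul]
        exact PiLp.norm_apply_le x j)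
    (P := fun j ζ ε => dirDeriv (spaceDir j) (mollify ζ ε u)) hcont
    (fun ζ hζ ε hε x => by
      ext m
      have hf : HasFDerivAt (fun y : Space d => mollify ζ ε u (0, y)) _ x :=
        ((hsm ζ hζ ε hε).differentiable (by simp) (0, x)).hasFDerivAt.comp x
          (hasFDerivAt_prodMk_right (0 : ℝ) x)
      rw [iteratedFDeriv_one_apply, hf.fderiv]
      have hm := sum_spaceDir ((0, m 0) : SpaceTime d)
      simp only [ContinuousLinearMap.comp_apply, ContinuousLinearMap.inr_apply]
      rw [hm]
      simp [dirDeriv, mul_comm]) (h := h) hh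
  refine ⟨_, h1, ?_⟩
  have hdecay : ∀ j z, Tendsto (fun s => dirDeriv (spaceDir j) (mollify η s u) z) atTop (𝓝 0) :=
    fun j z => by
      have h3 := tendsto_inv_atTop_zero.mul (tendsto_conv_parRescale_atTop hp hq
        (by linarith : 0 < β) (hK.kernel.dirDeriv (spaceDir j)) hu.mem z)
      rw [zero_mul] at h3
      refine h3.congr' ?_
      filter_upwards [eventually_gt_atTop 0] with s hs
      exact (congrFun (dirDeriv_conv_parRescale hul hK.kernel hs j) z).symm
  refine (morreyNorm_sum_le h2 (fun j => hbd j (hdecay j))).trans_eq ?_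
  rw [← Finset.sum_mul]
  congr 1
  push_cast
  exact Finset.sum_congr rfl fun j _ => (ENNReal.coe_toNNReal
    (traceConst_ne_top (by linarith) (by linarith) hβ (C j))).symm

end Assembly

/-! ### The trace theorem. -/

theorem lemma3p7 (d : ℕ) (hd : 2 ≤ d) (p q r β : ℝ) (hp : 1 < p) (hq : 1 < q) (hr : p ≤ r) :
    ∃ N : ℝ≥0, ∀ γ : ℕ, γ = 0 ∨ γ = 1 →
      2 - (γ : ℝ) < β → β ≤ d / p + 2 / q → d / p + 2 / q < 2 - (γ : ℝ) + d / r →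
      ∀ (u ut : SpaceTime d → ℝ) (Du : SpaceTime d → EuclideanSpace ℝ (Fin d))
        (D2u : SpaceTime d → EuclideanSpace ℝ (Fin d × Fin d)),
        MemParMorreySobolev p q β u ut Du D2u →
        (∃ v : Space d → (Space d [×0]→L[ℝ] ℝ), IsUniqueTrace 0 r u v) ∧
        ∃ g : Space d → (Space d [×γ]→L[ℝ] ℝ), IsUniqueTrace γ r u g ∧
          morreyNorm r (β + γ - 2) g ≤
            N * (parMorreyNorm p q β ut + parMorreyNorm p q β D2u) := by
  obtain ⟨N₀, h₀⟩ := exists_trace_zero (d := d) (β := β) hp hq hr (by omega)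
  obtain ⟨N₁, h₁⟩ := exists_trace_one (d := d) (β := β) hp hq hr (by omega)
  refine ⟨N₀ + N₁, fun γ hγ hβ _ hα u ut Du D2u hu => ?_⟩
  rcases hγ with rfl | rfl
  · simp only [Nat.cast_zero, sub_zero, add_zero] at hβ hα ⊢
    obtain ⟨v, hv, hbd⟩ := h₀ hα u ut Du D2u hu
    refine ⟨⟨v, hv⟩, v, hv, (hbd hβ).trans ?_⟩
    gcongr
    exact le_self_add
  · simp only [Nat.cast_one] at hβ hα ⊢
    -- The condition for the gradient trace is stronger by one than the condition for the existence
    -- of the trace of `u`.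
    obtain ⟨v, hv, -⟩ := h₀ (by linarith) u ut Du D2u hu
    obtain ⟨g, hg, hbd⟩ := h₁ (by linarith) (by linarith) u ut Du D2u hu
    refine ⟨⟨v, hv⟩, g, hg, ?_⟩
    rw [show β + 1 - 2 = β - 1 by ring]
    refine hbd.trans ?_
    gcongr
    exact le_add_self
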